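/- Let $A\in\mathbb R^{V\times V}$ be a symmetric real matrix indexed by a finite set $V$ (the weighted adjacency matrix of a graph). For a spin configuration $\sigma\in\{-1,1\}^V$ let $\mathcal C(\sigma)=\frac12\sum_{m,n}A_{mn}\,\frac{1-\sigma_m\sigma_n}{2}$ be the size of its cut. Every $x\in\mathbb R$ is uniquely $x=\sigma+X+4k$ with $\sigma\in\{-1,1\}$, $X\in(-1,1]$, $k\in\mathbb Z$; write $\mathrm{spin}(x)=\sigma$. The rounding of a state $\xi\in\mathbb R^V$ with respect to the rounding center $r\in\mathbb R$ is $\hat R_r[\xi]=(\mathrm{spin}(\xi_m-r))_{m\in V}$, and $\overline{\mathcal C}(\xi)=\max_{r\in\mathbb R}\mathcal C(\hat R_r[\xi])$ is the maximum cut that can be obtained by rounding $\xi$. Let $\mathcal C_{GW}(\xi)=\frac14\sum_{m,n}A_{mn}|\xi_m-\xi_n|_{[-2,2]}$, where $|\cdot|_{[-2,2]}$ is the $4$-periodic function equal to $|x|$ for $-2\le x\le 2$. The GW$_2$-machine is the gradient system $\dot\xi=\nabla\mathcal C_{GW}(\xi)$; as its right-hand side is discontinuous, solutions are meant in the sense of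 Filippov: a trajectory is a locally absolutely continuous curve $\xi:[0,\infty)\to\mathbb R^V$ with $\dot\xi(t)\in F(\xi(t))$ for almost every $t$, where $F(x)=\bigcap_{\delta>0}\bigcap_{|N|=0}\overline{\mathrm{co}}\,\nabla\mathcal C_{GW}(B(x,\delta)\setminus N)$. A state $z$ is critical if $0\in F(z)$. Then for every initial state $\xi^{(0)}\in\mathbb R^V$ (in particular, for every non-critical one) there is a trajectory starting at $\xi^{(0)}$, and every trajectory starting at $\xi^{(0)}$ reaches in finite time a terminal state $z=\xi(\infty\,|\,\xi^{(0)})$ at which it stays; $z$ is critical, the cut $\mathcal C(\hat R_r[z])=:\mathcal C(z)$ does not depend on $r$, and $$\mathcal C\bigl(\xi(\infty\,|\,\xi^{(0)})\bigr)\ \ge\ \overline{\mathcal C}\bigl(\xi^{(0)}\bigr).$$ -/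

import Mathlib

open MeasureTheory

namespace GW2

noncomputable section

/-- The counting function of a pair of spins: `1` if they differ, `0` if they agree. -/
def countingFunction (a b : ℝ) : ℝ := (1 - a * b) / 2

/-- The size (total weight) of the cut of the spin configuration `σ`, for the weighted
adjacency matrix `A`. -/
def cutSize {V : Type*} [Fintype V] (A : Matrix V V ℝ) (σ : V → ℝ) : ℝ :=
  (1 / 2) * ∑ m, ∑ n, A m n * countingFunction (σ m) (σ n)

/-- The `4`-periodic function equal to `|x|` on `[-2, 2]`: the distance on a circle of
circumference `4`. -/
def circleAbs (x : ℝ) : ℝ := ‖(x : AddCircle (4 : ℝ))‖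

/-- The 2D Goemans-Williamson objective function. -/
def objective {V : Type*} [Fintype V] (A : Matrix V V ℝ) (ξ : EuclideanSpace ℝ V) : ℝ :=
  (1 / 4) * ∑ m, ∑ n, A m n * circleAbs (ξ m - ξ n)

/-- The Filippov set-valued map of a (possibly discontinuous) vector field `f`: the
intersection, over all radii `δ > 0` and all null sets `N`, of the closed convex hulls of the
values of `f` on the `δ`-ball around `x` with `N` removed. -/
def filippovMap {E : Type*} [NormedAddCommGroup E] [NormedSpace ℝ E] [MeasureSpace E]
    (f : E → E) (x : E) : Set E :=
  ⋂ (δ : ℝ) (_ : 0 < δ) (N : Set E) (_ : volume N = 0),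
    closedConvexHull ℝ (f '' (Metric.ball x δ \ N))

/-- A trajectory of the machine: a locally absolutely continuous curve on `[0, ∞)` which, in
the sense of Filippov, solves the gradient system of the objective function. The gradient
exists off a null set, and the Filippov map does not depend on values on null sets, hence not
on the convention for the switching function at its jumps. -/
structure IsTrajectory {V : Type*} [Fintype V] (A : Matrix V V ℝ)
    (ξ : ℝ → EuclideanSpace ℝ V) : Prop where
  absolutelyContinuous : ∀ T : ℝ, 0 < T → AbsolutelyContinuousOnInterval ξ 0 T
  inclusion : ∀ᵐ t ∂(volume : Measure ℝ), 0 < t →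
    ∃ v ∈ filippovMap (gradient (objective A)) (ξ t), HasDerivAt ξ v t

/-- Critical states: the equilibria of the gradient system. -/
def IsCritical {V : Type*} [Fintype V] (A : Matrix V V ℝ) (z : EuclideanSpace ℝ V) : Prop :=
  (0 : EuclideanSpace ℝ V) ∈ filippovMap (gradient (objective A)) z

/-- `z` is the terminal state of the trajectory `ξ`: the trajectory reaches `z` in finite time
and stays there. -/
def IsTerminalState {V : Type*} (ξ : ℝ → EuclideanSpace ℝ V)
    (z : EuclideanSpace ℝ V) : Prop :=
  ∃ T : ℝ, 0 ≤ T ∧ ∀ t : ℝ, T ≤ t → ξ t = z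

/-- The spin `σ` of a real number written as `σ + X + 4 k`, with `σ = ±1`, `-1 < X ≤ 1`, `k` an
integer: it is `1` if the representative of the number in `(-2, 2]` is positive, and `-1`
otherwise. -/
def spin (x : ℝ) : ℝ :=
  if 0 < toIocMod (four_pos : (0 : ℝ) < 4) (-2) x then 1 else -1

/-- `spin x` is the binary component in the unique decomposition of `x`. -/
theorem spin_eq_iff (x σ : ℝ) :
    spin x = σ ↔ (σ = 1 ∨ σ = -1) ∧
      ∃ X ∈ Set.Ioc (-1 : ℝ) 1, ∃ k : ℤ, x = σ + X + 4 * (k : ℝ) := by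
  have hp : (0 : ℝ) < 4 := four_pos
  constructor
  · intro h
    have hm := toIocMod_mem_Ioc hp (-2) x
    have hx := toIocMod_add_toIocDiv_zsmul hp (-2) x
    rw [zsmul_eq_mul] at hx
    unfold spin at h
    split_ifs at h with h0
    · subst h
      refine ⟨Or.inl rfl, toIocMod hp (-2) x - 1, ⟨?_, ?_⟩, toIocDiv hp (-2) x, ?_⟩
      · linarith
      · linarith [hm.2]
      · linarith
    · subst h
      refine ⟨Or.inr rfl, toIocMod hp (-2) x + 1, ⟨?_, ?_⟩, toIocDiv hp (-2) x, ?_⟩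
      · linarith [hm.1]
      · linarith
      · linarith
  · rintro ⟨hσ, X, hX, k, hx⟩
    have hmod : toIocMod hp (-2) x = σ + X := by
      rw [toIocMod_eq_iff]
      refine ⟨?_, k, ?_⟩
      · rcases hσ with h | h <;> subst h <;> constructor <;> linarith [hX.1, hX.2]
      · rw [zsmul_eq_mul]; linarith
    unfold spin
    rw [hmod]
    rcases hσ with h | h <;> subst h
    · rw [if_pos (by linarith [hX.1])]
    · rw [if_neg (by linarith [hX.2])]

/-- Rounding of the state `ξ` with respect to the rounding center `r`. -/
def rounding {V : Type*} (r : ℝ) (ξ : EuclideanSpace ℝ V) : V → ℝ :=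
  fun m => spin (ξ m - r)

/-- The maximum cut that can be obtained by rounding `ξ`, over all rounding centers. -/
def maxRoundedCut {V : Type*} [Fintype V] (A : Matrix V V ℝ) (ξ : EuclideanSpace ℝ V) : ℝ :=
  ⨆ r : ℝ, cutSize A (rounding r ξ)

/-- The supremum in `maxRoundedCut` is a maximum. -/
theorem isGreatest_maxRoundedCut {V : Type*} [Fintype V] (A : Matrix V V ℝ)
    (ξ : EuclideanSpace ℝ V) :
    IsGreatest (Set.range fun r : ℝ => cutSize A (rounding r ξ)) (maxRoundedCut A ξ) := by
  have hfin : (Set.range fun r : ℝ => cutSize A (rounding r ξ)).Finite := by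
    have h1 : (Set.univ.pi fun _ : V => ({1, -1} : Set ℝ)).Finite :=
      Set.Finite.pi fun _ => Set.toFinite _
    refine (h1.image (cutSize A)).subset ?_
    rintro _ ⟨r, rfl⟩
    refine ⟨rounding r ξ, ?_, rfl⟩
    intro m _
    simp only [rounding, spin]
    split_ifs <;> simp
  have hne : (Set.range fun r : ℝ => cutSize A (rounding r ξ)).Nonempty :=
    Set.range_nonempty _
  exact ⟨hne.csSup_mem hfin, fun _ hy => le_csSup hfin.bddAbove hy⟩

end

end GW2

/-! The circular distance of two components is, up to a factor, the measure of the rounding centers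
that separate them, so the objective is the average of the rounded cuts. Group the components of a
state into clusters that agree modulo `2`. In cluster-constant directions the objective is affine
nearby, with slope given by `force`; hence all elements of the Filippov set have the same projection
to the cluster-constant vectors (`inner_eq_of_mem_filippovMap`). At almost every time the velocity
is itself cluster-constant (`ae_isClusterConst`), so it is the projection of `force`, and only
finitely many velocities occur.

For a short move along such a velocity `v` and a fixed rounding center, whole clusters flip, and the
cut changes by `2⟨force, u⟩ = 2⟨v, u⟩`, where `u` displaces the flipped components in the direction
of `v` (`exists_cutSize_rounding_add`). This is nonnegative. The maximum rounded cut can jump in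
time, so monotonicity is integrated for `levelMeasure` instead, which is Lipschitz in the state. The
centers that attain the initial maximum have positive measure; this measure cannot decrease, so the
maximum is never lost.

The objective grows at speed `‖v‖ ^ 2`, which is zero or bounded below. Zero velocity forces the
objective to equal a cut size, one of finitely many values; as the objective is bounded, it becomes
stationary in finite time, and then the state rests. At a critical state a shift of the center is a
rigid motion without virtual work, so all rounded cuts agree.

For existence, the objective is positively homogeneous around each state. Maximizing it with a
quadratic penalty yields a straight solution from each point, and Zorn's lemma with a uniform
Lipschitz bound gives a global one. -/

namespace GW2

/-! ### Spins as parities of half-circles -/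

theorem spin_of_mem_Ioc {x : ℝ} {k : ℤ} (h : x ∈ Set.Ioc (2 * (k : ℝ) - 2) (2 * k)) :
    spin x = -(-1) ^ k := by
  obtain ⟨h1, h2⟩ := h
  rw [spin_eq_iff]
  rcases Int.even_or_odd' k with ⟨j, rfl | rfl⟩
  · have : (-1 : ℝ) ^ (2 * j) = 1 := by rw [zpow_mul]; simp
    push_cast at h1 h2
    refine ⟨Or.inr (by rw [this]), x + 1 - 4 * j, ⟨by linarith, by linarith⟩, j, ?_⟩
    rw [this]; ring
  · have : (-1 : ℝ) ^ (2 * j + 1) = -1 := by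
      rw [zpow_add₀ (by norm_num), zpow_mul]; simp
    push_cast at h1 h2
    refine ⟨Or.inl (by rw [this]; norm_num), x - 1 - 4 * j, ⟨by linarith, by linarith⟩, j, ?_⟩
    rw [this]; ring

theorem mem_Ioc_ceil_half (x : ℝ) : x ∈ Set.Ioc (2 * (⌈x / 2⌉ : ℝ) - 2) (2 * ⌈x / 2⌉) :=
  ⟨by linarith [Int.ceil_lt_add_one (x / 2)], by linarith [Int.le_ceil (x / 2)]⟩

/-- Replaces the modular definition by a parity, so that shifts by multiples of `2` become sign
computations. -/
theorem spin_eq_ceil (x : ℝ) : spin x = -(-1) ^ ⌈x / 2⌉ := spin_of_mem_Ioc (mem_Ioc_ceil_half x)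

theorem neg_one_zpow_eq_or (k : ℤ) : (-1 : ℝ) ^ k = 1 ∨ (-1 : ℝ) ^ k = -1 := by
  rcases Int.even_or_odd k with h | h
  · exact Or.inl h.neg_one_zpow
  · exact Or.inr h.neg_one_zpow

theorem spin_eq_one_or (x : ℝ) : spin x = 1 ∨ spin x = -1 := ((spin_eq_iff x _).1 rfl).1

theorem spin_add_two_mul (x : ℝ) (k : ℤ) : spin (x + 2 * k) = (-1) ^ k * spin x := by
  have : (x + 2 * k) / 2 = x / 2 + k := by ring
  rw [spin_eq_ceil, spin_eq_ceil, this, Int.ceil_add_intCast, zpow_add₀ (by norm_num)]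
  ring

theorem spin_add_four_mul (x : ℝ) (k : ℤ) : spin (x + 4 * k) = spin x := by
  have h := spin_add_two_mul x (2 * k)
  rw [zpow_mul] at h
  push_cast at h
  rw [show x + 4 * (k : ℝ) = x + 2 * (2 * k) by ring, h]
  simp

theorem measurable_spin : Measurable spin := by
  have : spin = (fun k : ℤ => -(-1 : ℝ) ^ k) ∘ fun x : ℝ => ⌈x / 2⌉ := funext spin_eq_ceil
  rw [this]
  exact (measurable_of_countable _).comp (Int.measurable_ceil.comp (measurable_id.div_const 2))

/-- Reflection exchanges the half-open intervals except at their endpoints, the even integers, which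
are therefore excluded. -/
theorem spin_neg {x : ℝ} (hx : ∀ j : ℤ, x ≠ 2 * j) : spin (-x) = -spin x := by
  obtain ⟨h1, h2⟩ := mem_Ioc_ceil_half x
  have h3 : x < 2 * ⌈x / 2⌉ := lt_of_le_of_ne h2 (hx _)
  rw [spin_of_mem_Ioc (x := -x) (k := -⌈x / 2⌉ + 1), spin_eq_ceil x, zpow_add₀ (by norm_num),
    zpow_neg]
  · rcases neg_one_zpow_eq_or ⌈x / 2⌉ with h | h <;> simp [h]
  · push_cast
    constructor <;> linarith

/-- Rounding is constant to the right of each rounding center. -/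
theorem exists_spin_sub_eq (x : ℝ) : ∃ ε > 0, ∀ e, 0 ≤ e → e < ε → spin (x - e) = spin x := by
  obtain ⟨h1, h2⟩ := mem_Ioc_ceil_half x
  refine ⟨x - (2 * ⌈x / 2⌉ - 2), by linarith, fun e h0 he => ?_⟩
  rw [spin_eq_ceil x]
  exact spin_of_mem_Ioc ⟨by linarith, by linarith⟩

theorem exists_le_abs_sub_two_mul {x : ℝ} (hx : ∀ j : ℤ, x ≠ 2 * j) :
    ∃ d > 0, ∀ j : ℤ, d ≤ |x - 2 * j| := by
  obtain ⟨h1, h2⟩ := mem_Ioc_ceil_half x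
  have h3 : x < 2 * ⌈x / 2⌉ := lt_of_le_of_ne h2 (hx _)
  refine ⟨min (x - (2 * ⌈x / 2⌉ - 2)) (2 * ⌈x / 2⌉ - x), lt_min (by linarith) (by linarith), ?_⟩
  intro j
  rcases le_or_gt ⌈x / 2⌉ j with h | h
  · have : (⌈x / 2⌉ : ℝ) ≤ j := by exact_mod_cast h
    exact (min_le_right _ _).trans (le_abs.2 (Or.inr (by linarith)))
  · have : (j : ℝ) + 1 ≤ ⌈x / 2⌉ := by exact_mod_cast h
    exact (min_le_left _ _).trans (le_abs.2 (Or.inl (by linarith)))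

/-- If `x` has distance at least `d` from `2ℤ`, then it lies well inside one of the intervals
between consecutive even integers. -/
theorem exists_mem_Icc_of_le_abs {x d : ℝ} (hx : ∀ j : ℤ, d ≤ |x - 2 * j|) :
    ∃ j : ℤ, 2 * (j : ℝ) - 2 + d ≤ x ∧ x ≤ 2 * j - d := by
  obtain ⟨h1, h2⟩ := mem_Ioc_ceil_half x
  refine ⟨⌈x / 2⌉, ?_, ?_⟩
  · have := hx (⌈x / 2⌉ - 1)
    push_cast at this
    rw [abs_of_pos (by linarith)] at this
    linarith
  · have := hx ⌈x / 2⌉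
    rw [abs_of_nonpos (by linarith)] at this
    linarith

/-- If a small displacement `e` of `a` changes its spin, and `b` is far from `a` modulo `2`, then a
small displacement of `b` does not change its spin, and the relative spin of `a` and `b` is
determined by their difference. -/
theorem spin_displacement {a b d e e' : ℝ} (hd : ∀ j : ℤ, d ≤ |a - b - 2 * j|)
    (he : |e| < d / 2) (he' : |e'| < d / 2) (hne : spin (a + e) ≠ spin a) :
    spin (b + e') = spin b ∧ spin a * spin b = SignType.sign e * spin (a - b) := by
  have hd0 : 0 < d := by linarith [abs_nonneg e]
  obtain ⟨q, hq1, hq2⟩ := exists_mem_Icc_of_le_abs hd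
  have hd1 : d ≤ 1 := by linarith
  rw [abs_lt] at he he'
  obtain ⟨h1, h2⟩ := mem_Ioc_ceil_half a
  -- Here `2 * p` is the even integer that `a` crosses, and the sign of `e` tells from which side.
  have key : ∀ p : ℤ, |a - 2 * p| < d / 2 → spin a = -SignType.sign e * (-1) ^ p →
      spin (b + e') = spin b ∧ spin a * spin b = SignType.sign e * spin (a - b) := by
    intro p hp hs
    rw [abs_lt] at hp
    -- Since `a` is within `d / 2` of `2 * p` and `a - b` is `d`-deep in its interval, `b` is `d /
    -- 2`-deep in the interval of index `p - q + 1`.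
    have hb : spin b = -(-1) ^ (p - q + 1) :=
      spin_of_mem_Ioc ⟨by push_cast; linarith, by push_cast; linarith⟩
    have hb' : spin (b + e') = -(-1) ^ (p - q + 1) :=
      spin_of_mem_Ioc ⟨by push_cast; linarith, by push_cast; linarith⟩
    have hab : spin (a - b) = -(-1) ^ q := spin_of_mem_Ioc ⟨by linarith, by linarith⟩
    refine ⟨by rw [hb, hb'], ?_⟩
    rw [hs, hb, hab, zpow_add₀ (by norm_num), zpow_sub₀ (by norm_num)]
    rcases neg_one_zpow_eq_or p with h | h <;> rcases neg_one_zpow_eq_or q with h' | h' <;>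
      simp [h, h']
  rcases lt_or_ge (2 * (⌈a / 2⌉ : ℝ)) (a + e) with h | h
  · refine key ⌈a / 2⌉ (abs_lt.2 ⟨by linarith, by linarith⟩) ?_
    rw [sign_pos (by linarith), spin_eq_ceil a]; simp
  · rcases le_or_gt (a + e) (2 * (⌈a / 2⌉ : ℝ) - 2) with h' | h'
    · refine key (⌈a / 2⌉ - 1) ?_ ?_
      · push_cast
        exact abs_lt.2 ⟨by linarith, by linarith⟩
      · rw [sign_neg (by linarith), spin_eq_ceil a, zpow_sub₀ (by norm_num)]
        simp [div_neg]
    · exact absurd ((spin_of_mem_Ioc ⟨h', h⟩).trans (spin_eq_ceil a).symm) hne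

/-! ### Piecewise linearity of the circular distance -/

theorem circleAbs_eq_abs_sub {x : ℝ} (j : ℤ) (h : |x - 4 * j| ≤ 2) : circleAbs x = |x - 4 * j| := by
  have h1 : ((x - 4 * j : ℝ) : AddCircle (4 : ℝ)) = (x : AddCircle (4 : ℝ)) := by
    refine QuotientAddGroup.eq.2 (AddSubgroup.mem_zmultiples_iff.2 ⟨j, ?_⟩)
    rw [zsmul_eq_mul]
    ring
  refine (congrArg norm h1).symm.trans ((AddCircle.norm_coe_eq_abs_iff 4 (by norm_num)).2 ?_)
  rw [abs_of_pos (by norm_num : (0 : ℝ) < 4)]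
  linarith

theorem circleAbs_nonneg (x : ℝ) : 0 ≤ circleAbs x := norm_nonneg _

theorem exists_abs_sub_four_mul_le (x : ℝ) : ∃ j : ℤ, |x - 4 * j| ≤ 2 := by
  refine ⟨round (x / 4), ?_⟩
  have := abs_sub_round (x / 4)
  rw [abs_le] at this ⊢
  constructor <;> linarith

theorem circleAbs_le_two (x : ℝ) : circleAbs x ≤ 2 := by
  obtain ⟨j, hj⟩ := exists_abs_sub_four_mul_le x
  rw [circleAbs_eq_abs_sub j hj]
  exact hj

theorem abs_circleAbs_sub_le (x y : ℝ) : |circleAbs x - circleAbs y| ≤ |x - y| := by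
  refine (abs_norm_sub_norm_le _ _).trans ?_
  rw [← AddCircle.coe_sub]
  exact QuotientAddGroup.norm_mk_le_norm

theorem circleAbs_le_abs (x : ℝ) : circleAbs x ≤ |x| := by
  simpa [circleAbs] using (le_abs_self _).trans (abs_circleAbs_sub_le x 0)

theorem circleAbs_add_of_lt {a d u : ℝ} (hd : ∀ j : ℤ, d ≤ |a - 2 * j|) (hu : |u| < d) :
    circleAbs (a + u) = circleAbs a + spin a * u := by
  have hd0 : 0 < d := (abs_nonneg u).trans_lt hu
  obtain ⟨k, h1, h2⟩ := exists_mem_Icc_of_le_abs hd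
  rw [abs_lt] at hu
  rw [spin_of_mem_Ioc (k := k) ⟨by linarith, by linarith⟩]
  rcases Int.even_or_odd' k with ⟨j, rfl | rfl⟩
  · have : (-1 : ℝ) ^ (2 * j) = 1 := by rw [zpow_mul]; simp
    push_cast at h1 h2
    have e1 : |a + u - 4 * j| = 4 * j - (a + u) := by rw [abs_of_nonpos] <;> linarith
    have e2 : |a - 4 * j| = 4 * j - a := by rw [abs_of_nonpos] <;> linarith
    rw [circleAbs_eq_abs_sub j (by linarith), circleAbs_eq_abs_sub j (by linarith), this, e1, e2]
    ring
  · have : (-1 : ℝ) ^ (2 * j + 1) = -1 := by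
      rw [zpow_add₀ (by norm_num), zpow_mul]; simp
    push_cast at h1 h2
    have e1 : |a + u - 4 * j| = a + u - 4 * j := by rw [abs_of_nonneg]; linarith
    have e2 : |a - 4 * j| = a - 4 * j := by rw [abs_of_nonneg]; linarith
    rw [circleAbs_eq_abs_sub j (by linarith), circleAbs_eq_abs_sub j (by linarith), this, e1, e2]
    ring

/-- `circleAbs` is affine near each point off `2ℤ`. -/
theorem circleAbs_sub_eq {a d w w' : ℝ} (hd : ∀ j : ℤ, d ≤ |a - 2 * j|) (hw : |w - a| < d)
    (hw' : |w' - a| < d) : circleAbs w' - circleAbs w = spin a * (w' - w) := by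
  have h1 := circleAbs_add_of_lt hd hw
  have h2 := circleAbs_add_of_lt hd hw'
  rw [add_sub_cancel] at h1 h2
  rw [h1, h2]; ring

/-- The kinks are the even integers: there the function looks like `|v|` (at multiples of `4`) or `2
- |v|` (halfway between). Elsewhere it is locally affine. -/
theorem circleAbs_locally_homogeneous (a : ℝ) : ∃ ρ > 0, ∀ u l : ℝ, |u| < ρ → 0 ≤ l → l ≤ 1 →
    circleAbs (a + l * u) - circleAbs a = l * (circleAbs (a + u) - circleAbs a) := by
  by_cases ha : ∃ j : ℤ, a = 2 * j
  · obtain ⟨j, rfl⟩ := ha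
    refine ⟨2, by norm_num, fun u l hu h0 h1 => ?_⟩
    have hlu : |l * u| ≤ |u| := by
      rw [abs_mul, abs_of_nonneg h0]
      exact mul_le_of_le_one_left (abs_nonneg _) h1
    rcases Int.even_or_odd' j with ⟨i, rfl | rfl⟩
    · have key : ∀ v : ℝ, |v| ≤ 2 → circleAbs (2 * ((2 * i : ℤ) : ℝ) + v) = |v| := by
        intro v hv
        have : 2 * ((2 * i : ℤ) : ℝ) + v - 4 * i = v := by push_cast; ring
        rw [circleAbs_eq_abs_sub i (by rwa [this]), this]
      have h00 := key 0 (by norm_num)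
      rw [add_zero, abs_zero] at h00
      rw [key _ hu.le, key _ (by linarith), h00, abs_mul, abs_of_nonneg h0]
      ring
    · have key : ∀ v : ℝ, |v| ≤ 2 → circleAbs (2 * ((2 * i + 1 : ℤ) : ℝ) + v) = 2 - |v| := by
        intro v hv
        rcases le_total 0 v with h | h
        · have e : 2 * ((2 * i + 1 : ℤ) : ℝ) + v - 4 * ((i + 1 : ℤ) : ℝ) = v - 2 := by
            push_cast; ring
          rw [abs_of_nonneg h] at hv ⊢
          have e2 : |v - 2| = 2 - v := by rw [abs_of_nonpos] <;> linarith
          rw [circleAbs_eq_abs_sub (i + 1) (by rw [e, e2]; linarith), e, e2]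
        · have e : 2 * ((2 * i + 1 : ℤ) : ℝ) + v - 4 * (i : ℝ) = v + 2 := by
            push_cast; ring
          rw [abs_of_nonpos h] at hv ⊢
          have e2 : |v + 2| = 2 + v := by rw [abs_of_nonneg] <;> linarith
          rw [circleAbs_eq_abs_sub i (by rw [e, e2]; linarith), e, e2]
          ring
      have h00 := key 0 (by norm_num)
      rw [add_zero, abs_zero] at h00
      rw [key _ hu.le, key _ (by linarith), h00, abs_mul, abs_of_nonneg h0]
      ring
  · push Not at ha
    obtain ⟨d, hd, h⟩ := exists_le_abs_sub_two_mul ha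
    refine ⟨d, hd, fun u l hu h0 h1 => ?_⟩
    have hlu : |l * u| ≤ |u| := by
      rw [abs_mul, abs_of_nonneg h0]
      exact mul_le_of_le_one_left (abs_nonneg _) h1
    rw [circleAbs_add_of_lt h hu, circleAbs_add_of_lt h (hlu.trans_lt hu)]
    ring

/-! ### The circular distance as a measure of separating centers -/

theorem countingFunction_spin_nonneg (x y : ℝ) : 0 ≤ countingFunction (spin x) (spin y) := by
  rcases spin_eq_one_or x with h | h <;> rcases spin_eq_one_or y with h' | h' <;>
    norm_num [countingFunction, h, h']

theorem countingFunction_spin_le_one (x y : ℝ) : countingFunction (spin x) (spin y) ≤ 1 := by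
  rcases spin_eq_one_or x with h | h <;> rcases spin_eq_one_or y with h' | h' <;>
    norm_num [countingFunction, h, h']

theorem measurable_countingFunction_spin {f g : ℝ → ℝ} (hf : Measurable f) (hg : Measurable g) :
    Measurable fun r => countingFunction (spin (f r)) (spin (g r)) := by
  unfold countingFunction
  exact ((measurable_const.sub ((measurable_spin.comp hf).mul (measurable_spin.comp hg))).div_const 2)

theorem intervalIntegrable_of_measurable_of_abs_le {f : ℝ → ℝ} (hf : Measurable f) {C : ℝ}
    (hC : ∀ x, |f x| ≤ C) (a b : ℝ) : IntervalIntegrable f volume a b :=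
  (intervalIntegrable_const (c := C)).mono_fun' hf.aestronglyMeasurable
    (Filter.Eventually.of_forall fun x => hC x)

theorem intervalIntegrable_countingFunction_spin {f g : ℝ → ℝ} (hf : Measurable f)
    (hg : Measurable g) (a b : ℝ) :
    IntervalIntegrable (fun r => countingFunction (spin (f r)) (spin (g r))) volume a b :=
  intervalIntegrable_of_measurable_of_abs_le (measurable_countingFunction_spin hf hg) (C := 1)
    (fun x => by
      rw [abs_of_nonneg (countingFunction_spin_nonneg _ _)]
      exact countingFunction_spin_le_one _ _) a b

theorem integral_eq_mul_of_forall_mem_Ioc {f : ℝ → ℝ} {a b c : ℝ} (hab : a ≤ b)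
    (h : ∀ x ∈ Set.Ioc a b, f x = c) : ∫ x in a..b, f x = (b - a) * c := by
  rw [intervalIntegral.integral_congr_ae (g := fun _ => c)]
  · simp
  · refine Filter.Eventually.of_forall fun x hx => h x ?_
    rwa [Set.uIoc_of_le hab] at hx

/-- The spins of `s` and `s + d` differ on two arcs of length `d`, one before each sign change of
`spin`: `(-d, 0]` and `(2 - d, 2]`. -/
theorem integral_countingFunction_spin_add {d : ℝ} (h0 : 0 ≤ d) (h2 : d ≤ 2) :
    ∫ s in (-2 : ℝ)..2, countingFunction (spin (s + d)) (spin s) = 2 * d := by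
  have hi : ∀ a b : ℝ, IntervalIntegrable
      (fun s => countingFunction (spin (s + d)) (spin s)) volume a b := fun a b =>
    intervalIntegrable_countingFunction_spin (measurable_id.add_const d) measurable_id a b
  have hm : ∀ x : ℝ, -2 < x → x ≤ 0 → spin x = -1 := fun x h h' => by
    rw [spin_of_mem_Ioc (k := 0) ⟨by push_cast; linarith, by push_cast; linarith⟩]; norm_num
  have hp : ∀ x : ℝ, 0 < x → x ≤ 2 → spin x = 1 := fun x h h' => by
    rw [spin_of_mem_Ioc (k := 1) ⟨by push_cast; linarith, by push_cast; linarith⟩]; norm_num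
  have hq : ∀ x : ℝ, 2 < x → x ≤ 4 → spin x = -1 := fun x h h' => by
    rw [spin_of_mem_Ioc (k := 2) ⟨by push_cast; linarith, by push_cast; linarith⟩]; norm_num
  rw [← intervalIntegral.integral_add_adjacent_intervals (hi (-2) 0) (hi 0 2),
    ← intervalIntegral.integral_add_adjacent_intervals (hi (-2) (-d)) (hi (-d) 0),
    ← intervalIntegral.integral_add_adjacent_intervals (hi 0 (2 - d)) (hi (2 - d) 2),
    integral_eq_mul_of_forall_mem_Ioc (c := 0) (by linarith),
    integral_eq_mul_of_forall_mem_Ioc (c := 1) (by linarith),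
    integral_eq_mul_of_forall_mem_Ioc (c := 0) (by linarith),
    integral_eq_mul_of_forall_mem_Ioc (c := 1) (by linarith)]
  · ring
  · rintro x ⟨h, h'⟩
    rw [hq (x + d) (by linarith) (by linarith), hp x (by linarith) h']; norm_num [countingFunction]
  · rintro x ⟨h, h'⟩
    rw [hp (x + d) (by linarith) (by linarith), hp x h (by linarith)]; norm_num [countingFunction]
  · rintro x ⟨h, h'⟩
    rw [hp (x + d) (by linarith) (by linarith), hm x (by linarith) h']; norm_num [countingFunction]
  · rintro x ⟨h, h'⟩
    rw [hm (x + d) (by linarith) (by linarith), hm x h (by linarith)]; norm_num [countingFunction]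

theorem countingFunction_comm (a b : ℝ) : countingFunction a b = countingFunction b a := by
  unfold countingFunction; ring

/-- The circular distance is, up to a factor, the measure of the set of rounding centers that
separate two points. -/
theorem integral_countingFunction_spin (a b : ℝ) :
    ∫ r in (0 : ℝ)..4, countingFunction (spin (a - r)) (spin (b - r)) = 2 * circleAbs (a - b) := by
  have main : ∀ (d b : ℝ), 0 ≤ d → d ≤ 2 →
      ∫ r in (0 : ℝ)..4, countingFunction (spin (b - r + d)) (spin (b - r)) = 2 * d := by
    intro d b h0 h2
    have hper : Function.Periodic (fun s => countingFunction (spin (s + d)) (spin s)) 4 := by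
      intro s
      have h1 := spin_add_four_mul s 1
      have h2 := spin_add_four_mul (s + d) 1
      rw [Int.cast_one, mul_one] at h1 h2
      simp only
      rw [h1, show s + 4 + d = s + d + 4 by ring, h2]
    have h := intervalIntegral.integral_comp_sub_left (a := 0) (b := 4)
      (fun s => countingFunction (spin (s + d)) (spin s)) b
    rw [h, sub_zero]
    have h3 := hper.intervalIntegral_add_eq (b - 4) (-2)
    rw [sub_add_cancel, show (-2 : ℝ) + 4 = 2 by norm_num] at h3
    rw [h3, integral_countingFunction_spin_add h0 h2]
  obtain ⟨j, hj⟩ := exists_abs_sub_four_mul_le (a - b)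
  rw [circleAbs_eq_abs_sub j hj]
  rcases le_total 0 (a - b - 4 * j) with h | h
  · rw [abs_of_nonneg h] at hj ⊢
    rw [← main _ b h hj]
    congr 1
    ext r
    rw [← spin_add_four_mul (b - r + (a - b - 4 * j)) j]
    ring_nf
  · rw [abs_of_nonpos h] at hj ⊢
    rw [← main _ a (by linarith) hj]
    congr 1
    ext r
    rw [countingFunction_comm, ← spin_add_four_mul (b - r) j]
    ring_nf

end GW2

/-! ### Clusters of aligned components and the force on them -/

namespace GW2

open Filter Topology

variable {V : Type*}

/-- Two components are aligned if they agree modulo `2`. -/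
def Aligned (x : EuclideanSpace ℝ V) (m n : V) : Prop := ∃ k : ℤ, x m - x n = 2 * k

/-- Vectors that are constant on the clusters of aligned components of `x`. -/
def IsClusterConst (x u : EuclideanSpace ℝ V) : Prop := ∀ m n, Aligned x m n → u m = u n

open Classical in
/-- The weight of a pair of components, signed by their relative spin, with aligned pairs
discarded. -/
noncomputable def signedWeight (A : Matrix V V ℝ) (x : EuclideanSpace ℝ V) (m n : V) : ℝ :=
  if Aligned x m n then 0 else A m n * spin (x m - x n)

theorem Aligned.symm {x : EuclideanSpace ℝ V} {m n : V} (h : Aligned x m n) : Aligned x n m := by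
  obtain ⟨k, hk⟩ := h
  exact ⟨-k, by push_cast; linarith⟩

theorem IsClusterConst.sub {x u v : EuclideanSpace ℝ V} (hu : IsClusterConst x u)
    (hv : IsClusterConst x v) : IsClusterConst x (u - v) := fun m n h => by
  simp [hu m n h, hv m n h]

theorem IsClusterConst.smul {x u : EuclideanSpace ℝ V} (hu : IsClusterConst x u) (s : ℝ) :
    IsClusterConst x (s • u) := fun m n h => by
  simp [hu m n h]

/-- Action equals reaction: `spin` is odd off the even integers, and the pairs where oddness could
fail have been discarded. -/
theorem signedWeight_symm {A : Matrix V V ℝ} (hA : A.IsSymm) (x : EuclideanSpace ℝ V) (m n : V) :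
    signedWeight A x n m = -signedWeight A x m n := by
  unfold signedWeight
  by_cases h : Aligned x m n
  · rw [if_pos h, if_pos h.symm, neg_zero]
  · have h' : ¬Aligned x n m := fun h' => h h'.symm
    rw [if_neg h, if_neg h', hA.apply m n, ← neg_sub, spin_neg]
    · ring
    · exact fun j hj => h ⟨j, hj⟩

/-- Lets a change of the rounding center be studied as a motion of the state. -/
theorem rounding_add_const (x : EuclideanSpace ℝ V) (r e : ℝ) :
    rounding r (x + e • WithLp.toLp 2 fun _ => 1) = rounding (r - e) x := by
  funext m
  simp only [rounding, PiLp.add_apply, PiLp.smul_apply, smul_eq_mul, mul_one]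
  congr 1
  ring

variable [Fintype V]

/-- The force that the components not aligned with a given one exert on it. -/
noncomputable def force (A : Matrix V V ℝ) (x : EuclideanSpace ℝ V) : EuclideanSpace ℝ V :=
  WithLp.toLp 2 fun m => 1 / 2 * ∑ n, signedWeight A x m n

theorem inner_force (A : Matrix V V ℝ) (x u : EuclideanSpace ℝ V) :
    inner ℝ (force A x) u = 1 / 2 * ∑ m, ∑ n, signedWeight A x m n * u m := by
  simp only [PiLp.inner_apply, force, RCLike.inner_apply, conj_trivial, Finset.mul_sum]
  refine Finset.sum_congr rfl fun m _ => Finset.sum_congr rfl fun n _ => ?_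
  ring

theorem exists_gap (x : EuclideanSpace ℝ V) :
    ∃ d > 0, ∀ m n, ¬Aligned x m n → ∀ j : ℤ, d ≤ |x m - x n - 2 * j| := by
  have h : ∀ᶠ d in 𝓝[>] (0 : ℝ), ∀ m n, ¬Aligned x m n → ∀ j : ℤ, d ≤ |x m - x n - 2 * j| := by
    refine eventually_all.2 fun m => eventually_all.2 fun n => ?_
    by_cases hmn : Aligned x m n
    · exact Eventually.of_forall fun d h => absurd hmn h
    · obtain ⟨d, hd, hj⟩ := exists_le_abs_sub_two_mul (x := x m - x n)
        fun j hj => hmn ⟨j, hj⟩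
      filter_upwards [Ioo_mem_nhdsGT hd] with e he _ j
      exact he.2.le.trans (hj j)
  obtain ⟨d, hd, hd'⟩ := (h.and self_mem_nhdsWithin).exists
  exact ⟨d, hd', hd⟩

theorem abs_apply_le_norm (x : EuclideanSpace ℝ V) (m : V) : |x m| ≤ ‖x‖ :=
  PiLp.norm_apply_le x m

theorem abs_sub_sub_sub_le (x y : EuclideanSpace ℝ V) (m n : V) :
    |(x m - x n) - (y m - y n)| ≤ 2 * ‖x - y‖ := by
  have h1 := abs_apply_le_norm (x - y) m
  have h2 := abs_apply_le_norm (x - y) n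
  simp only [PiLp.sub_apply] at h1 h2
  rw [abs_le] at *
  constructor <;> linarith

theorem exists_lipschitzWith_objective (A : Matrix V V ℝ) : ∃ K, LipschitzWith K (objective A) := by
  refine ⟨_, LipschitzWith.of_dist_le' (K := 1 / 4 * ∑ m, ∑ n, |A m n| * 2) fun x y => ?_⟩
  rw [dist_eq_norm, dist_eq_norm, Real.norm_eq_abs, objective, objective, ← mul_sub,
    ← Finset.sum_sub_distrib, abs_mul, abs_of_pos (by norm_num : (0 : ℝ) < 1 / 4), mul_assoc]
  refine mul_le_mul_of_nonneg_left ?_ (by norm_num)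
  rw [Finset.sum_mul]
  refine (Finset.abs_sum_le_sum_abs _ _).trans (Finset.sum_le_sum fun m _ => ?_)
  rw [← Finset.sum_sub_distrib, Finset.sum_mul]
  refine (Finset.abs_sum_le_sum_abs _ _).trans (Finset.sum_le_sum fun n _ => ?_)
  rw [← mul_sub, abs_mul, mul_assoc]
  exact mul_le_mul_of_nonneg_left ((abs_circleAbs_sub_le _ _).trans (abs_sub_sub_sub_le _ _ _ _))
    (abs_nonneg _)

theorem exists_objective_le (A : Matrix V V ℝ) : ∃ C, ∀ x, objective A x ≤ C := by
  refine ⟨1 / 4 * ∑ m, ∑ n, |A m n| * 2, fun x => ?_⟩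
  refine mul_le_mul_of_nonneg_left ?_ (by norm_num)
  refine Finset.sum_le_sum fun m _ => Finset.sum_le_sum fun n _ => ?_
  exact mul_le_mul (le_abs_self _) (circleAbs_le_two _) (circleAbs_nonneg _) (abs_nonneg _)

theorem objective_locally_homogeneous (A : Matrix V V ℝ) (x : EuclideanSpace ℝ V) :
    ∃ ρ > 0, ∀ u : EuclideanSpace ℝ V, ∀ l : ℝ, ‖u‖ < ρ → 0 ≤ l → l ≤ 1 →
      objective A (x + l • u) - objective A x = l * (objective A (x + u) - objective A x) := by
  have h : ∀ᶠ ρ in 𝓝[>] (0 : ℝ), ∀ m n, ∀ u l : ℝ, |u| < ρ → 0 ≤ l → l ≤ 1 →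
      circleAbs (x m - x n + l * u) - circleAbs (x m - x n) =
        l * (circleAbs (x m - x n + u) - circleAbs (x m - x n)) := by
    refine eventually_all.2 fun m => eventually_all.2 fun n => ?_
    obtain ⟨d, hd, h⟩ := circleAbs_locally_homogeneous (x m - x n)
    filter_upwards [Ioo_mem_nhdsGT hd] with e he u l hu
    exact h u l (hu.trans he.2)
  obtain ⟨ρ, hρ, hρ0⟩ := (h.and self_mem_nhdsWithin).exists
  replace hρ0 : 0 < ρ := hρ0
  -- Differences of components are bounded by twice the norm.
  refine ⟨ρ / 2, by linarith, fun u l hu h0 h1 => ?_⟩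
  have key : ∀ m n, circleAbs ((x + l • u) m - (x + l • u) n) - circleAbs (x m - x n) =
      l * (circleAbs ((x + u) m - (x + u) n) - circleAbs (x m - x n)) := by
    intro m n
    have hmn : |u m - u n| < ρ := by
      have := abs_sub_sub_sub_le u 0 m n
      simp only [PiLp.zero_apply, sub_zero] at this
      linarith
    have := hρ m n _ l hmn h0 h1
    simp only [PiLp.add_apply, PiLp.smul_apply, smul_eq_mul]
    rw [show x m + l * u m - (x n + l * u n) = x m - x n + l * (u m - u n) by ring, this,
      show x m + u m - (x n + u n) = x m - x n + (u m - u n) by ring]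
  simp only [objective, ← mul_sub, ← Finset.sum_sub_distrib, key, Finset.mul_sum]
  refine Finset.sum_congr rfl fun m _ => Finset.sum_congr rfl fun n _ => ?_
  ring

/-- Near `x`, the objective function is affine in the directions that move the clusters of `x` as a
whole. -/
theorem exists_objective_sub_eq {A : Matrix V V ℝ} (hA : A.IsSymm) (x : EuclideanSpace ℝ V) :
    ∃ ε > 0, ∀ y ∈ Metric.ball x ε, ∀ y' ∈ Metric.ball x ε, IsClusterConst x (y' - y) →
      objective A y' - objective A y = inner ℝ (force A x) (y' - y) := by
  obtain ⟨d, hd, hgap⟩ := exists_gap x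
  refine ⟨d / 2, by linarith, fun y hy y' hy' hc => ?_⟩
  rw [mem_ball_iff_norm] at hy hy'
  have key : ∀ m n, A m n * circleAbs (y' m - y' n) - A m n * circleAbs (y m - y n) =
      signedWeight A x m n * (y' - y) m - signedWeight A x m n * (y' - y) n := by
    intro m n
    unfold signedWeight
    by_cases h : Aligned x m n
    · have := hc m n h
      simp only [PiLp.sub_apply] at this
      rw [if_pos h, show y' m - y' n = y m - y n by linarith]
      ring
    · rw [if_neg h, ← mul_sub, circleAbs_sub_eq (hgap m n h)
        ((abs_sub_sub_sub_le _ _ _ _).trans_lt (by linarith))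
        ((abs_sub_sub_sub_le _ _ _ _).trans_lt (by linarith))]
      simp only [PiLp.sub_apply]
      ring
  rw [objective, objective, ← mul_sub, ← Finset.sum_sub_distrib, inner_force]
  simp only [← Finset.sum_sub_distrib, key]
  simp only [Finset.sum_sub_distrib]
  -- By antisymmetry the two sums are opposite, which turns the factor `1 / 4` of the objective into
  -- the `1 / 2` of `force`.
  have h2 : ∑ m, ∑ n, signedWeight A x m n * (y' - y) n =
      -∑ m, ∑ n, signedWeight A x m n * (y' - y) m := by
    rw [Finset.sum_comm, ← Finset.sum_neg_distrib]
    refine Finset.sum_congr rfl fun m _ => ?_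
    rw [← Finset.sum_neg_distrib]
    refine Finset.sum_congr rfl fun n _ => ?_
    rw [signedWeight_symm hA]
    ring
  rw [h2]
  ring

/-- The base point ranges over a whole ball, with the slope still taken at `x`, because the Filippov
set at `x` is built from gradients at nearby points. -/
theorem hasDerivAt_objective_add_smul {A : Matrix V V ℝ} (hA : A.IsSymm)
    (x : EuclideanSpace ℝ V) : ∃ ε > 0, ∀ y ∈ Metric.ball x ε, ∀ u, IsClusterConst x u →
      HasDerivAt (fun s : ℝ => objective A (y + s • u)) (inner ℝ (force A x) u) 0 := by
  obtain ⟨ε, hε, h⟩ := exists_objective_sub_eq hA x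
  refine ⟨ε, hε, fun y hy u hu => ?_⟩
  have h1 : HasDerivAt (fun s : ℝ => objective A y + s * inner ℝ (force A x) u)
      (inner ℝ (force A x) u) 0 := by
    simpa using ((hasDerivAt_id (0 : ℝ)).mul_const (inner ℝ (force A x) u)).const_add
      (objective A y)
  refine h1.congr_of_eventuallyEq ?_
  have hcont : Continuous fun s : ℝ => y + s • u := by fun_prop
  have hmem : ∀ᶠ s in 𝓝 (0 : ℝ), y + s • u ∈ Metric.ball x ε :=
    hcont.continuousAt.eventually_mem (by simpa using Metric.isOpen_ball.mem_nhds hy)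
  filter_upwards [hmem] with s hs
  have := h y hy _ hs (by rw [add_sub_cancel_left]; exact hu.smul s)
  rw [add_sub_cancel_left, inner_smul_right] at this
  linarith

/-! ### Filippov sets tested against cluster-constant vectors -/

theorem filippovMap_subset {E : Type*} [NormedAddCommGroup E] [NormedSpace ℝ E] [MeasureSpace E]
    {f : E → E} {x : E} {ε : ℝ} (hε : 0 < ε) {N : Set E} (hN : volume N = 0) :
    filippovMap f x ⊆ closedConvexHull ℝ (f '' (Metric.ball x ε \ N)) := fun _ hv => by
  simp only [filippovMap, Set.mem_iInter] at hv
  exact hv ε hε N hN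

theorem volume_not_differentiableAt_objective (A : Matrix V V ℝ) :
    volume {y | ¬DifferentiableAt ℝ (objective A) y} = 0 := by
  obtain ⟨K, hK⟩ := exists_lipschitzWith_objective A
  exact hK.ae_differentiableAt

/-- The total force on each cluster is the same for all elements of the Filippov set. -/
theorem inner_eq_of_mem_filippovMap {A : Matrix V V ℝ} (hA : A.IsSymm)
    {x v : EuclideanSpace ℝ V} (hv : v ∈ filippovMap (gradient (objective A)) x)
    {u : EuclideanSpace ℝ V} (hu : IsClusterConst x u) :
    inner ℝ v u = inner ℝ (force A x) u := by
  obtain ⟨ε, hε, h⟩ := hasDerivAt_objective_add_smul hA x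
  have h1 := filippovMap_subset hε (volume_not_differentiableAt_objective A) hv
  have hlin : IsLinearMap ℝ fun w : EuclideanSpace ℝ V => inner ℝ w u :=
    ⟨fun a b => inner_add_left a b u, fun c a => by simp [inner_smul_left]⟩
  -- The condition defines a closed hyperplane, so it suffices to check it for gradients at nearby
  -- points of differentiability.
  refine closedConvexHull_min (t := {w | inner ℝ w u = inner ℝ (force A x) u}) ?_
    (convex_hyperplane hlin _) (isClosed_eq (by fun_prop) continuous_const) h1
  rintro _ ⟨y, ⟨hy, hyN⟩, rfl⟩
  have hd : DifferentiableAt ℝ (objective A) y := not_not.1 hyN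
  have hl : HasDerivAt (fun s : ℝ => y + s • u) u 0 := by
    simpa using ((hasDerivAt_id (0 : ℝ)).smul_const u).const_add y
  have h2 : HasFDerivAt (objective A) (fderiv ℝ (objective A) y) (y + (0 : ℝ) • u) := by
    simpa using hd.hasFDerivAt
  have h3 := HasDerivAt.unique (h y hy u hu)
    (HasFDerivAt.comp_hasDerivAt (l := objective A) (0 : ℝ) h2 hl)
  change inner ℝ (gradient (objective A) y) u = _
  rw [h3, inner_gradient_left]

/-! ### Change of a rounded cut under motion of clusters -/

/-- With `κ` the indicator of the flipped spins, only pairs with exactly one flip contribute;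
symmetry of `A` merges the two orders of such a pair. -/
theorem cutSize_sub_eq {A : Matrix V V ℝ} (hA : A.IsSymm) {σ τ κ : V → ℝ}
    (h : ∀ m, τ m = σ m * (1 - 2 * κ m)) :
    cutSize A τ - cutSize A σ = ∑ m, ∑ n, A m n * (σ m * σ n * (κ m * (1 - κ n))) := by
  have h1 : ∑ m, ∑ n, A m n * countingFunction (τ m) (τ n) -
      ∑ m, ∑ n, A m n * countingFunction (σ m) (σ n) =
      ∑ m, ∑ n, A m n * (σ m * σ n * (κ m * (1 - κ n))) +
      ∑ m, ∑ n, A m n * (σ m * σ n * (κ n * (1 - κ m))) := by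
    simp only [← Finset.sum_sub_distrib, ← Finset.sum_add_distrib]
    refine Finset.sum_congr rfl fun m _ => Finset.sum_congr rfl fun n _ => ?_
    rw [h, h, countingFunction, countingFunction]
    ring
  have h2 : ∑ m, ∑ n, A m n * (σ m * σ n * (κ n * (1 - κ m))) =
      ∑ m, ∑ n, A m n * (σ m * σ n * (κ m * (1 - κ n))) := by
    rw [Finset.sum_comm]
    refine Finset.sum_congr rfl fun m _ => Finset.sum_congr rfl fun n _ => ?_
    rw [hA.apply m n]
    ring
  rw [cutSize, cutSize, ← mul_sub, h1, h2]
  ring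

open Classical in
/-- If the clusters of `x` are moved as a whole and by small amounts, the change of the cut obtained
by rounding is twice the virtual work along a displacement with the directions of the motion. -/
theorem exists_cutSize_rounding_add {A : Matrix V V ℝ} (hA : A.IsSymm) {x v : EuclideanSpace ℝ V}
    (hv : IsClusterConst x v) : ∃ ρ > 0, ∀ h : ℝ, 0 < h → h < ρ → ∀ r, ∃ u, IsClusterConst x u ∧
      (∀ m, 0 ≤ u m * v m) ∧ cutSize A (rounding r (x + h • v)) =
        cutSize A (rounding r x) + 2 * inner ℝ (force A x) u := by
  obtain ⟨d, hd, hgap⟩ := exists_gap x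
  refine ⟨d / 2 / (‖v‖ + 1), by positivity, fun h h0 hh r => ?_⟩
  have hsmall : ∀ m, |h * v m| < d / 2 := by
    intro m
    rw [lt_div_iff₀ (by positivity)] at hh
    rw [abs_mul, abs_of_pos h0]
    refine lt_of_le_of_lt ?_ hh
    exact mul_le_mul_of_nonneg_left (by linarith [abs_apply_le_norm v m]) h0.le
  let κ : V → ℝ := fun m => if spin (x m - r + h * v m) ≠ spin (x m - r) then 1 else 0
  -- Aligned components stay congruent modulo `2` during the motion, so they flip together.
  have hκ : ∀ m n, Aligned x m n → κ m = κ n := by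
    rintro m n ⟨k, hk⟩
    have e1 : x m - r = x n - r + 2 * k := by linarith
    have e2 : x m - r + h * v m = x n - r + h * v n + 2 * k := by
      rw [e1, hv m n ⟨k, hk⟩]; ring
    have e3 : spin (x m - r + h * v m) ≠ spin (x m - r) ↔
        spin (x n - r + h * v n) ≠ spin (x n - r) := by
      rw [e2, e1, spin_add_two_mul, spin_add_two_mul]
      rcases neg_one_zpow_eq_or k with h | h <;> simp [h]
    simp only [κ, e3]
  -- The displacement moves each flipped component by one unit in the direction of `v`.
  refine ⟨WithLp.toLp 2 fun m => κ m * SignType.sign (v m), ?_, ?_, ?_⟩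
  · intro m n hmn
    simp only [hκ m n hmn, hv m n hmn]
  · intro m
    simp only
    rw [mul_assoc, sign_mul_self]
    refine mul_nonneg ?_ (abs_nonneg _)
    simp only [κ]
    split_ifs <;> norm_num
  · have h1 : ∀ m, rounding r (x + h • v) m = rounding r x m * (1 - 2 * κ m) := by
      intro m
      simp only [rounding, PiLp.add_apply, PiLp.smul_apply, smul_eq_mul, κ]
      rw [show x m + h * v m - r = x m - r + h * v m by ring]
      split_ifs with hne
      · rcases spin_eq_one_or (x m - r + h * v m) with h | h <;>
          rcases spin_eq_one_or (x m - r) with h' | h' <;> rw [h, h'] at hne ⊢ <;>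
          first | exact absurd rfl hne | norm_num
      · rw [not_not.1 hne]; ring
    rw [← sub_eq_iff_eq_add', cutSize_sub_eq hA h1, inner_force, ← mul_assoc,
      show (2 : ℝ) * (1 / 2) = 1 by norm_num, one_mul]
    refine Finset.sum_congr rfl fun m _ => Finset.sum_congr rfl fun n _ => ?_
    simp only [rounding]
    by_cases hm : spin (x m - r + h * v m) ≠ spin (x m - r)
    · have hκm : κ m = 1 := if_pos hm
      by_cases hmn : Aligned x m n
      · rw [signedWeight, if_pos hmn, ← hκ m n hmn, hκm]
        ring
      · have h2 := spin_displacement (a := x m - r) (b := x n - r) (d := d)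
          (by simpa using hgap m n hmn) (hsmall m) (hsmall n) hm
        have hκn : κ n = 0 := if_neg (not_not.2 h2.1)
        rw [signedWeight, if_neg hmn, hκn, hκm, h2.2, sign_mul, sign_pos h0,
          show x m - r - (x n - r) = x m - x n by ring]
        rw [SignType.coe_mul, SignType.coe_one]
        ring
    · have hκm : κ m = 0 := if_neg hm
      rw [hκm]
      ring

/-- Rigid motion is cluster-constant, so it does no virtual work and small shifts of the center
leave the cut unchanged. As the admissible size `ρ` does not depend on `r`, the cut is locally
constant on the connected line. -/
theorem cutSize_rounding_eq_of_force {A : Matrix V V ℝ} (hA : A.IsSymm) {z : EuclideanSpace ℝ V}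
    (hz : ∀ u, IsClusterConst z u → inner ℝ (force A z) u = 0) (r s : ℝ) :
    cutSize A (rounding r z) = cutSize A (rounding s z) := by
  obtain ⟨ρ, hρ, h⟩ := exists_cutSize_rounding_add hA (x := z)
    (v := WithLp.toLp 2 fun _ => (1 : ℝ)) fun _ _ _ => rfl
  have hstep : ∀ r e, 0 < e → e < ρ →
      cutSize A (rounding (r - e) z) = cutSize A (rounding r z) := by
    intro r e h0 h1
    obtain ⟨u, hu, -, hcut⟩ := h e h0 h1 r
    rw [rounding_add_const, hz u hu] at hcut
    simpa using hcut
  have hloc : IsLocallyConstant fun r => cutSize A (rounding r z) := by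
    rw [IsLocallyConstant.iff_eventually_eq]
    intro r
    filter_upwards [Metric.ball_mem_nhds r hρ] with s hs
    rw [Metric.mem_ball, Real.dist_eq, abs_lt] at hs
    rcases lt_trichotomy s r with hsr | hsr | hsr
    · have := hstep r (r - s) (by linarith) (by linarith)
      rwa [sub_sub_cancel] at this
    · rw [hsr]
    · have := hstep s (s - r) (by linarith) (by linarith)
      rw [sub_sub_cancel] at this
      exact this.symm
  exact hloc.apply_eq_of_preconnectedSpace r s

/-! ### The objective as an average of cuts -/

theorem finite_range_cutSize_rounding (A : Matrix V V ℝ) :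
    (Set.range fun p : ℝ × EuclideanSpace ℝ V => cutSize A (rounding p.1 p.2)).Finite := by
  have h1 : (Set.univ.pi fun _ : V => ({1, -1} : Set ℝ)).Finite :=
    Set.Finite.pi fun _ => Set.toFinite _
  refine (h1.image (cutSize A)).subset ?_
  rintro _ ⟨p, rfl⟩
  refine ⟨rounding p.1 p.2, fun m _ => ?_, rfl⟩
  rcases spin_eq_one_or (p.2 m - p.1) with h | h <;> simp [rounding, h]

theorem measurable_cutSize_rounding (A : Matrix V V ℝ) (x : EuclideanSpace ℝ V) :
    Measurable fun r => cutSize A (rounding r x) := by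
  refine Measurable.const_mul (Finset.measurable_sum _ fun m _ => Finset.measurable_sum _
    fun n _ => Measurable.const_mul (measurable_countingFunction_spin ?_ ?_) _) _
  · exact measurable_const.sub measurable_id
  · exact measurable_const.sub measurable_id

/-- The objective function is the average of the cuts obtained by rounding. -/
theorem integral_cutSize_rounding (A : Matrix V V ℝ) (x : EuclideanSpace ℝ V) :
    ∫ r in (0 : ℝ)..4, cutSize A (rounding r x) = 4 * objective A x := by
  have hi : ∀ m n, IntervalIntegrable (fun r => A m n * countingFunction (rounding r x m)
      (rounding r x n)) volume 0 4 := fun m n =>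
    (intervalIntegrable_countingFunction_spin (measurable_const.sub measurable_id)
      (measurable_const.sub measurable_id) 0 4).const_mul _
  have hi' : ∀ m, IntervalIntegrable (fun r => ∑ n, A m n * countingFunction (rounding r x m)
      (rounding r x n)) volume 0 4 := fun m => by
    simpa only [Finset.sum_fn] using IntervalIntegrable.sum Finset.univ fun n _ => hi m n
  simp only [cutSize]
  rw [intervalIntegral.integral_const_mul, intervalIntegral.integral_finsetSum fun m _ => hi' m,
    objective, ← mul_assoc, Finset.mul_sum, Finset.mul_sum]
  refine Finset.sum_congr rfl fun m _ => ?_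
  rw [intervalIntegral.integral_finsetSum fun n _ => hi m n, Finset.mul_sum, Finset.mul_sum]
  refine Finset.sum_congr rfl fun n _ => ?_
  rw [intervalIntegral.integral_const_mul]
  simp only [rounding]
  rw [integral_countingFunction_spin]
  ring

/-- The average of a constant function of the center is that constant; thus critical values are cut
sizes. -/
theorem objective_eq_of_force {A : Matrix V V ℝ} (hA : A.IsSymm) {z : EuclideanSpace ℝ V}
    (hz : ∀ u, IsClusterConst z u → inner ℝ (force A z) u = 0) :
    objective A z = cutSize A (rounding 0 z) := by
  have h := integral_cutSize_rounding A z
  rw [integral_eq_mul_of_forall_mem_Ioc (c := cutSize A (rounding 0 z)) (by norm_num)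
    fun r _ => cutSize_rounding_eq_of_force hA hz r 0] at h
  linarith

end GW2

/-! ### Differentiation along curves -/

namespace GW2

open Filter Topology

variable {V : Type*}

/-- If the velocities of two aligned components differ at `t`, their difference leaves the value `2
* k` at once, so `t` is isolated in a level set. Each level set has countably many such points. -/
theorem ae_isClusterConst (ξ : ℝ → EuclideanSpace ℝ V) [Fintype V] :
    ∀ᵐ t : ℝ, ∀ v, HasDerivAt ξ v t → IsClusterConst (ξ t) v := by
  have h : ∀ᵐ t : ℝ, ∀ m n, ∀ k : ℤ, ∀ v, HasDerivAt ξ v t → ξ t m - ξ t n = 2 * k → v m = v n := by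
    refine eventually_all.2 fun m => eventually_all.2 fun n => ae_all_iff.2 fun k => ?_
    have hc := countable_setOfPred_isolated_right_within
      (s := {t : ℝ | ξ t m - ξ t n = 2 * (k : ℝ)})
    filter_upwards [hc.ae_notMem volume] with t ht v hv hk
    by_contra hne
    refine ht ⟨hk, ?_⟩
    have hm : HasDerivAt (fun s => ξ s m) (v m) t := 
      (EuclideanSpace.proj m : EuclideanSpace ℝ V →L[ℝ] ℝ).hasFDerivAt.comp_hasDerivAt t hv
    have hn : HasDerivAt (fun s => ξ s n) (v n) t := 
      (EuclideanSpace.proj n : EuclideanSpace ℝ V →L[ℝ] ℝ).hasFDerivAt.comp_hasDerivAt t hv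
    have h1 := (hm.sub hn).eventually_ne (c := 2 * (k : ℝ)) (sub_ne_zero.2 hne)
    have h2 : ∀ᶠ s in 𝓝[{t : ℝ | ξ t m - ξ t n = 2 * (k : ℝ)} ∩ Set.Ioi t] t, False := by
      filter_upwards [h1.filter_mono (nhdsWithin_mono t fun s hs => (ne_of_gt hs.2 : s ≠ t)),
        self_mem_nhdsWithin] with s hs hs'
      exact hs hs'.1
    exact eventually_false_iff_eq_bot.1 h2
  filter_upwards [h] with t ht v hv m n ⟨k, hk⟩
  exact ht m n k v hv hk

/-- Replacing the curve by its tangent line costs `o(s)`, which a Lipschitz function preserves; `f`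
need not be differentiable. -/
theorem LipschitzWith.hasDerivAt_comp_iff {E : Type*} [NormedAddCommGroup E] [NormedSpace ℝ E]
    {f : E → ℝ} {K : NNReal} (hf : LipschitzWith K f) {ξ : ℝ → E} {v : E} {t c : ℝ}
    (hξ : HasDerivAt ξ v t) :
    HasDerivAt (fun s => f (ξ s)) c t ↔ HasDerivAt (fun s : ℝ => f (ξ t + s • v)) c 0 := by
  rw [hasDerivAt_iff_isLittleO_nhds_zero] at hξ ⊢
  rw [hasDerivAt_iff_isLittleO_nhds_zero]
  have h : (fun s : ℝ => f (ξ (t + s)) - f (ξ t + s • v)) =o[𝓝 0] fun s : ℝ => s := by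
    refine Asymptotics.IsBigO.trans_isLittleO (Asymptotics.IsBigO.of_bound K ?_) hξ
    refine Eventually.of_forall fun s => ?_
    have := hf.norm_sub_le (ξ (t + s)) (ξ t + s • v)
    rwa [← sub_sub] at this
  constructor
  · intro h1
    refine (h1.sub h).congr_left fun s => ?_
    simp only [zero_add, zero_smul, add_zero]
    ring
  · intro h1
    refine (h1.add h).congr_left fun s => ?_
    simp only [zero_add, zero_smul, add_zero]
    ring

theorem LipschitzWith.absolutelyContinuousOnInterval_comp {X Y : Type*} [PseudoMetricSpace X]
    [PseudoMetricSpace Y] {f : X → Y} {K : NNReal} (hf : LipschitzWith K f) {ξ : ℝ → X} {a b : ℝ}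
    (hξ : AbsolutelyContinuousOnInterval ξ a b) :
    AbsolutelyContinuousOnInterval (fun t => f (ξ t)) a b := by
  rw [absolutelyContinuousOnInterval_iff] at hξ ⊢
  intro ε hε
  obtain ⟨δ, hδ, h⟩ := hξ (ε / (K + 1)) (by positivity)
  refine ⟨δ, hδ, fun E hE hlt => ?_⟩
  have h1 := h E hE hlt
  rw [lt_div_iff₀ (by positivity)] at h1
  refine lt_of_le_of_lt ?_ h1
  rw [Finset.sum_mul]
  refine Finset.sum_le_sum fun i _ => (hf.dist_le_mul _ _).trans ?_
  rw [mul_comm]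
  exact mul_le_mul_of_nonneg_left (by linarith) dist_nonneg

theorem AbsolutelyContinuousOnInterval.mul_sub_le {f : ℝ → ℝ} {a b c : ℝ} (hab : a ≤ b)
    (hf : AbsolutelyContinuousOnInterval f a b)
    (hc : ∀ᵐ t : ℝ, t ∈ Set.Ioc a b → ∀ d, HasDerivAt f d t → c ≤ d) :
    c * (b - a) ≤ f b - f a := by
  rw [← hf.integral_deriv_eq_sub]
  have h1 : ∫ _ in a..b, c = c * (b - a) := by
    rw [intervalIntegral.integral_const, smul_eq_mul, mul_comm]
  rw [← h1]
  refine intervalIntegral.integral_mono_ae_restrict hab intervalIntegrable_const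
    hf.intervalIntegrable_deriv ?_
  have : ∀ᵐ t : ℝ, t ∈ Set.Icc a b → c ≤ deriv f t := by
    filter_upwards [hc, hf.ae_differentiableAt, (Set.countable_singleton a).ae_notMem volume]
      with t h1 h2 h3 h4
    refine h1 ⟨lt_of_le_of_ne h4.1 fun h => h3 h.symm, h4.2⟩ _ (h2 ?_).hasDerivAt
    rwa [Set.uIcc_of_le hab]
  exact (ae_restrict_iff' measurableSet_Icc).2 this

/-! ### Measure of the good rounding centers -/

variable [Fintype V]

/-- The measure of the set of rounding centers for which rounding gives a cut of size at
least `c`. -/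
noncomputable def levelMeasure (A : Matrix V V ℝ) (c : ℝ) (x : EuclideanSpace ℝ V) : ℝ :=
  ∫ r in (0 : ℝ)..4, Set.indicator {r | c ≤ cutSize A (rounding r x)} (fun _ => (1 : ℝ)) r

theorem intervalIntegrable_level (A : Matrix V V ℝ) (c : ℝ) (x : EuclideanSpace ℝ V) (a b : ℝ) :
    IntervalIntegrable (Set.indicator {r | c ≤ cutSize A (rounding r x)} (fun _ => (1 : ℝ)))
      volume a b := by
  refine intervalIntegrable_of_measurable_of_abs_le (C := 1) (measurable_const.indicator
    (measurableSet_le measurable_const (measurable_cutSize_rounding A x))) (fun r => ?_) a b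
  simp only [Set.indicator]
  split_ifs <;> norm_num

theorem levelMeasure_le_of_le {A : Matrix V V ℝ} {c : ℝ} {x y : EuclideanSpace ℝ V}
    (h : ∀ r, cutSize A (rounding r x) ≤ cutSize A (rounding r y)) :
    levelMeasure A c x ≤ levelMeasure A c y := by
  refine intervalIntegral.integral_mono_on (by norm_num) (intervalIntegrable_level A c x 0 4)
    (intervalIntegrable_level A c y 0 4) fun r _ => ?_
  exact Set.indicator_le_indicator_of_subset (fun s (hs : c ≤ _) => hs.trans (h s))
    (fun _ => zero_le_one) r

/-- The two indicators can differ only at centers separating some `x m` from `y m`, and the measure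
of these is `2 * circleAbs (x m - y m)`. -/
theorem levelMeasure_sub_le (A : Matrix V V ℝ) (c : ℝ) (x y : EuclideanSpace ℝ V) :
    levelMeasure A c x - levelMeasure A c y ≤ 2 * Fintype.card V * ‖x - y‖ := by
  have hi : ∀ m ∈ Finset.univ, IntervalIntegrable
      (fun r => countingFunction (spin (x m - r)) (spin (y m - r))) volume 0 4 := fun m _ =>
    intervalIntegrable_countingFunction_spin (measurable_const.sub measurable_id)
      (measurable_const.sub measurable_id) 0 4
  have hi' : IntervalIntegrable
      (fun r => ∑ m, countingFunction (spin (x m - r)) (spin (y m - r))) volume 0 4 := by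
    simpa only [Finset.sum_fn] using IntervalIntegrable.sum Finset.univ hi
  rw [levelMeasure, levelMeasure, ← intervalIntegral.integral_sub (intervalIntegrable_level A c x 0 4)
    (intervalIntegrable_level A c y 0 4)]
  calc _ ≤ ∫ r in (0 : ℝ)..4, ∑ m, countingFunction (spin (x m - r)) (spin (y m - r)) := by
        refine intervalIntegral.integral_mono_on (by norm_num)
          ((intervalIntegrable_level A c x 0 4).sub (intervalIntegrable_level A c y 0 4)) hi'
          fun r _ => ?_
        by_cases h : ∀ m, spin (x m - r) = spin (y m - r)
        · have : rounding r x = rounding r y := funext h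
          simp only [Set.indicator, Set.mem_ofPred_eq, this, sub_self]
          exact Finset.sum_nonneg fun m _ => countingFunction_spin_nonneg _ _
        · push Not at h
          obtain ⟨m, hm⟩ := h
          have h1 : countingFunction (spin (x m - r)) (spin (y m - r)) = 1 := by
            rcases spin_eq_one_or (x m - r) with h | h <;>
              rcases spin_eq_one_or (y m - r) with h' | h' <;> rw [h, h'] at hm ⊢ <;>
              first | exact absurd rfl hm | norm_num [countingFunction]
          have h2 := Finset.single_le_sum (f := fun m => countingFunction (spin (x m - r))
            (spin (y m - r))) (fun m _ => countingFunction_spin_nonneg _ _) (Finset.mem_univ m)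
          simp only [h1] at h2
          refine le_trans ?_ h2
          simp only [Set.indicator]
          split_ifs <;> norm_num
    _ = ∑ m, 2 * circleAbs (x m - y m) := by
        rw [intervalIntegral.integral_finsetSum hi]
        exact Finset.sum_congr rfl fun m _ => integral_countingFunction_spin _ _
    _ ≤ ∑ m : V, 2 * ‖x - y‖ := by
        refine Finset.sum_le_sum fun m _ => mul_le_mul_of_nonneg_left ?_ (by norm_num)
        exact (circleAbs_le_abs _).trans (abs_apply_le_norm (x - y) m)
    _ = 2 * Fintype.card V * ‖x - y‖ := by
        rw [Finset.sum_const, Finset.card_univ, nsmul_eq_mul]; ring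

theorem exists_lipschitzWith_levelMeasure (A : Matrix V V ℝ) (c : ℝ) :
    ∃ K, LipschitzWith K (levelMeasure A c) := by
  refine ⟨_, LipschitzWith.of_dist_le' (K := 2 * Fintype.card V) fun x y => ?_⟩
  rw [Real.dist_eq, dist_eq_norm, abs_le]
  constructor
  · have := levelMeasure_sub_le A c y x
    rw [norm_sub_rev] at this
    linarith
  · exact levelMeasure_sub_le A c x y

/-- A maximizing center remains maximizing when slightly increased, because the spin intervals are
closed on the right; periodicity moves the window of integration to start at that center. -/
theorem levelMeasure_maxRoundedCut_pos (A : Matrix V V ℝ) (x : EuclideanSpace ℝ V) :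
    0 < levelMeasure A (maxRoundedCut A x) x := by
  obtain ⟨r, hr⟩ := (isGreatest_maxRoundedCut A x).1
  simp only at hr
  have h : ∀ᶠ ε in 𝓝[>] (0 : ℝ), ∀ m, ∀ e, 0 ≤ e → e < ε →
      spin (x m - r - e) = spin (x m - r) := by
    refine eventually_all.2 fun m => ?_
    obtain ⟨d, hd, h⟩ := exists_spin_sub_eq (x m - r)
    filter_upwards [Ioo_mem_nhdsGT hd] with ε hε e h0 he
    exact h e h0 (he.trans hε.2)
  obtain ⟨ε, ⟨hε, hε4⟩, hε0⟩ :=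
    ((h.and (Ioo_mem_nhdsGT (by norm_num : (0 : ℝ) < 4))).and self_mem_nhdsWithin).exists
  replace hε0 : 0 < ε := hε0
  have hper : Function.Periodic (Set.indicator {s | maxRoundedCut A x ≤ cutSize A (rounding s x)}
      (fun _ => (1 : ℝ))) 4 := by
    intro s
    have : rounding (s + 4) x = rounding s x := by
      funext m
      simp only [rounding]
      rw [← spin_add_four_mul (x m - (s + 4)) 1]
      congr 1
      push_cast
      ring
    simp only [Set.indicator, Set.mem_ofPred_eq, this]
  have h1 := hper.intervalIntegral_add_eq 0 r
  rw [zero_add] at h1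
  rw [levelMeasure, h1, ← intervalIntegral.integral_add_adjacent_intervals
    (intervalIntegrable_level A _ x r (r + ε / 2)) (intervalIntegrable_level A _ x (r + ε / 2) _)]
  refine add_pos_of_pos_of_nonneg ?_ ?_
  · rw [integral_eq_mul_of_forall_mem_Ioc (c := 1) (by linarith)]
    · linarith
    · intro s hs
      have : rounding s x = rounding r x := by
        funext m
        have := hε m (s - r) (by linarith [hs.1]) (by linarith [hs.2])
        rw [sub_sub, add_sub_cancel] at this
        exact this
      rw [Set.indicator_of_mem]
      rw [Set.mem_ofPred_eq, this, hr]
  · exact intervalIntegral.integral_nonneg (by linarith [hε4.2])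
      fun s _ => Set.indicator_nonneg (fun _ _ => zero_le_one) s

theorem exists_cutSize_ge_of_levelMeasure_pos {A : Matrix V V ℝ} {c : ℝ} {x : EuclideanSpace ℝ V}
    (h : 0 < levelMeasure A c x) : ∃ r, c ≤ cutSize A (rounding r x) := by
  by_contra hne
  have : {r | c ≤ cutSize A (rounding r x)} = ∅ :=
    Set.eq_empty_of_forall_notMem fun r hr => hne ⟨r, hr⟩
  rw [levelMeasure, this] at h
  simp at h

/-! ### Velocities: finiteness and monotonicity -/

/-- The possible velocities of a trajectory at `x`. -/
structure IsVelocity (A : Matrix V V ℝ) (x v : EuclideanSpace ℝ V) : Prop where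
  isClusterConst : IsClusterConst x v
  inner_eq : ∀ u, IsClusterConst x u → inner ℝ v u = inner ℝ (force A x) u

/-- A velocity is the projection of `force` to the cluster-constant vectors, and both depend only on
the alignment relation and the table of relative spins. -/
theorem finite_setOf_isVelocity (A : Matrix V V ℝ) : {v | ∃ x, IsVelocity A x v}.Finite := by
  let D := (V → V → Prop) × (V → V → Prop)
  let F : {v | ∃ x, IsVelocity A x v} → D := fun v =>
    (Aligned v.2.choose, fun m n => spin (v.2.choose m - v.2.choose n) = 1)
  refine Set.finite_coe_iff.1 (Finite.of_injective F ?_)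
  rintro ⟨v, hv⟩ ⟨w, hw⟩ h
  obtain ⟨h1, h2⟩ := Prod.ext_iff.1 h
  have hv' := hv.choose_spec
  have hw' := hw.choose_spec
  simp only [F] at h1 h2
  generalize hv.choose = x at hv' h1 h2
  generalize hw.choose = y at hw' h1 h2
  have hcc : ∀ u, IsClusterConst x u ↔ IsClusterConst y u := fun u => by
    simp only [IsClusterConst, h1]
  have hsp : ∀ m n, spin (x m - x n) = spin (y m - y n) := fun m n => by
    have := congrFun (congrFun h2 m) n
    rcases spin_eq_one_or (x m - x n) with h | h <;>
      rcases spin_eq_one_or (y m - y n) with h' | h' <;> rw [h, h'] at this ⊢ <;> norm_num at this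
  have hf : force A x = force A y := by
    have hw : ∀ m n, signedWeight A x m n = signedWeight A y m n := fun m n => by
      rw [signedWeight, signedWeight, hsp]
      by_cases h : Aligned x m n
      · rw [if_pos h, if_pos (h1 ▸ h)]
      · rw [if_neg h, if_neg (h1 ▸ h)]
    simp only [force, hw]
  have hvw := hv'.isClusterConst.sub ((hcc w).2 hw'.isClusterConst)
  have h3 := hv'.inner_eq _ hvw
  have h4 := hw'.inner_eq _ ((hcc _).1 hvw)
  rw [Subtype.mk_eq_mk, ← sub_eq_zero, ← inner_self_eq_zero (𝕜 := ℝ), inner_sub_left, h3, h4, hf,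
    sub_self]

theorem exists_le_norm_sq_of_isVelocity (A : Matrix V V ℝ) :
    ∃ c > 0, ∀ x v, IsVelocity A x v → v ≠ 0 → c ≤ ‖v‖ ^ 2 := by
  have hfin : ({v | ∃ x, IsVelocity A x v} \ {0}).Finite := (finite_setOf_isVelocity A).sdiff
  rcases ({v | ∃ x, IsVelocity A x v} \ {0}).eq_empty_or_nonempty with h | h
  · refine ⟨1, one_pos, fun x v hv hne => ?_⟩
    exact absurd ⟨⟨x, hv⟩, hne⟩ (Set.eq_empty_iff_forall_notMem.1 h v)
  · obtain ⟨w, hw, hmin⟩ := Set.exists_min_image _ (fun v => ‖v‖ ^ 2) hfin h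
    exact ⟨‖w‖ ^ 2, pow_pos (norm_pos_iff.2 hw.2) 2, fun x v hv hne => hmin v ⟨⟨x, hv⟩, hne⟩⟩

/-- The virtual displacement `u` has the signs of `v`, so `⟨force, u⟩ = ⟨v, u⟩ ≥ 0`. -/
theorem IsVelocity.exists_cutSize_rounding_le {A : Matrix V V ℝ} (hA : A.IsSymm)
    {x v : EuclideanSpace ℝ V} (hv : IsVelocity A x v) : ∃ ρ > 0, ∀ h : ℝ, 0 < h → h < ρ →
      ∀ r, cutSize A (rounding r x) ≤ cutSize A (rounding r (x + h • v)) := by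
  obtain ⟨ρ, hρ, H⟩ := exists_cutSize_rounding_add hA hv.isClusterConst
  refine ⟨ρ, hρ, fun h h0 h1 r => ?_⟩
  obtain ⟨u, hu, hpos, hcut⟩ := H h h0 h1 r
  rw [hcut, ← hv.inner_eq u hu]
  have : 0 ≤ inner ℝ v u := by
    rw [PiLp.inner_apply]
    refine Finset.sum_nonneg fun m _ => ?_
    simpa using hpos m
  linarith

theorem IsVelocity.hasDerivAt_objective {A : Matrix V V ℝ} (hA : A.IsSymm)
    {ξ : ℝ → EuclideanSpace ℝ V} {t : ℝ} {v : EuclideanSpace ℝ V} (hv : IsVelocity A (ξ t) v)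
    (hξ : HasDerivAt ξ v t) : HasDerivAt (fun s => objective A (ξ s)) (‖v‖ ^ 2) t := by
  obtain ⟨K, hK⟩ := exists_lipschitzWith_objective A
  obtain ⟨ε, hε, h⟩ := hasDerivAt_objective_add_smul hA (ξ t)
  rw [LipschitzWith.hasDerivAt_comp_iff hK hξ, ← real_inner_self_eq_norm_sq,
    hv.inner_eq v hv.isClusterConst]
  exact h _ (Metric.mem_ball_self hε) v hv.isClusterConst

theorem IsVelocity.deriv_levelMeasure_nonneg {A : Matrix V V ℝ} (hA : A.IsSymm) {c d : ℝ}
    {ξ : ℝ → EuclideanSpace ℝ V} {t : ℝ} {v : EuclideanSpace ℝ V} (hv : IsVelocity A (ξ t) v)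
    (hξ : HasDerivAt ξ v t) (hd : HasDerivAt (fun s => levelMeasure A c (ξ s)) d t) : 0 ≤ d := by
  obtain ⟨K, hK⟩ := exists_lipschitzWith_levelMeasure A c
  rw [LipschitzWith.hasDerivAt_comp_iff hK hξ] at hd
  obtain ⟨ρ, hρ, h⟩ := hv.exists_cutSize_rounding_le hA
  -- The comparison of cuts holds for forward motion only, so right-hand slopes are used.
  have h1 := (hasDerivWithinAt_iff_tendsto_slope' Set.self_notMem_Ioi).1
    (hd.hasDerivWithinAt (s := Set.Ioi 0))
  refine ge_of_tendsto h1 ?_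
  filter_upwards [Ioo_mem_nhdsGT hρ] with s hs
  rw [slope_def_field, zero_smul, add_zero]
  exact div_nonneg (sub_nonneg.2 (levelMeasure_le_of_le (h s hs.1 hs.2)))
    (by rw [sub_zero]; exact hs.1.le)

/-! ### Monotonicity and termination of trajectories -/

namespace IsTrajectory

variable {A : Matrix V V ℝ} {ξ : ℝ → EuclideanSpace ℝ V}

theorem ae_isVelocity (hA : A.IsSymm) (hξ : IsTrajectory A ξ) :
    ∀ᵐ t : ℝ, 0 < t → ∃ v ∈ filippovMap (gradient (objective A)) (ξ t),
      HasDerivAt ξ v t ∧ IsVelocity A (ξ t) v := by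
  filter_upwards [hξ.inclusion, ae_isClusterConst ξ] with t h1 h2 ht
  obtain ⟨v, hv, hd⟩ := h1 ht
  exact ⟨v, hv, hd, h2 v hd, fun u hu => inner_eq_of_mem_filippovMap hA hv hu⟩

theorem absolutelyContinuousOnInterval (hξ : IsTrajectory A ξ) {a b : ℝ} (ha : 0 ≤ a)
    (hab : a ≤ b) : AbsolutelyContinuousOnInterval ξ a b := by
  refine (hξ.absolutelyContinuous (b + 1) (by linarith)).mono ?_
  rw [Set.uIcc_of_le hab, Set.uIcc_of_le (by linarith)]
  exact Set.Icc_subset_Icc ha (by linarith)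

theorem levelMeasure_le (hA : A.IsSymm) (hξ : IsTrajectory A ξ) (c : ℝ) {T : ℝ} (hT : 0 ≤ T) :
    levelMeasure A c (ξ 0) ≤ levelMeasure A c (ξ T) := by
  obtain ⟨K, hK⟩ := exists_lipschitzWith_levelMeasure A c
  have h := AbsolutelyContinuousOnInterval.mul_sub_le (c := 0) hT
    (LipschitzWith.absolutelyContinuousOnInterval_comp hK
      (hξ.absolutelyContinuousOnInterval le_rfl hT)) ?_
  · linarith
  · filter_upwards [hξ.ae_isVelocity hA] with t h1 ht d hd
    obtain ⟨v, -, hv, hv'⟩ := h1 ht.1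
    exact hv'.deriv_levelMeasure_nonneg hA hv hd

theorem mul_sub_le_objective_sub (hA : A.IsSymm) (hξ : IsTrajectory A ξ) {a b c : ℝ} (ha : 0 ≤ a)
    (hab : a ≤ b) (hc : ∀ t ∈ Set.Ioc a b, ∀ v, IsVelocity A (ξ t) v → c ≤ ‖v‖ ^ 2) :
    c * (b - a) ≤ objective A (ξ b) - objective A (ξ a) := by
  obtain ⟨K, hK⟩ := exists_lipschitzWith_objective A
  refine AbsolutelyContinuousOnInterval.mul_sub_le hab
    (LipschitzWith.absolutelyContinuousOnInterval_comp hK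
      (hξ.absolutelyContinuousOnInterval ha hab)) ?_
  filter_upwards [hξ.ae_isVelocity hA] with t h1 ht d hd
  obtain ⟨v, -, hv, hv'⟩ := h1 (ha.trans_lt ht.1)
  rw [hd.unique (hv'.hasDerivAt_objective hA hv)]
  exact hc t ht v hv'

theorem objective_le (hA : A.IsSymm) (hξ : IsTrajectory A ξ) {a b : ℝ} (ha : 0 ≤ a)
    (hab : a ≤ b) : objective A (ξ a) ≤ objective A (ξ b) := by
  have := hξ.mul_sub_le_objective_sub hA ha hab (c := 0) fun t _ v _ => by positivity
  linarith

/-- The objective function becomes stationary in finite time: its speed of growth is bounded below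
as long as it avoids the finitely many critical values. -/
theorem exists_objective_eq (hA : A.IsSymm) (hξ : IsTrajectory A ξ) :
    ∃ T, 0 ≤ T ∧ ∀ t, T ≤ t → objective A (ξ t) = objective A (ξ T) := by
  obtain ⟨C, hC⟩ := exists_objective_le A
  obtain ⟨c, hc, hspeed⟩ := exists_le_norm_sq_of_isVelocity A
  let S := (fun t => objective A (ξ t)) '' Set.Ici 0
  have hbdd : BddAbove S := ⟨C, by rintro _ ⟨t, -, rfl⟩; exact hC _⟩
  have hne : S.Nonempty := ⟨_, 0, Set.self_mem_Ici, rfl⟩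
  have hle : ∀ t, 0 ≤ t → objective A (ξ t) ≤ sSup S := fun t ht => le_csSup hbdd ⟨t, ht, rfl⟩
  by_cases hmax : ∃ T, 0 ≤ T ∧ objective A (ξ T) = sSup S
  · obtain ⟨T, hT, hTS⟩ := hmax
    exact ⟨T, hT, fun t ht => le_antisymm ((hle t (hT.trans ht)).trans hTS.ge)
      (hξ.objective_le hA hT ht)⟩
  · exfalso
    push Not at hmax
    have hlt : ∀ t, 0 ≤ t → objective A (ξ t) < sSup S := fun t ht =>
      lt_of_le_of_ne (hle t ht) (hmax t ht)
    -- Choose `y` so close below the supremum that no rounded cut has its size in `[y, sSup S)`.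
    have hev : ∀ᶠ y in 𝓝[<] (sSup S), ∀ z ∈ Set.range fun p : ℝ × EuclideanSpace ℝ V =>
        cutSize A (rounding p.1 p.2), z < sSup S → z < y := by
      refine (eventually_all_finite (finite_range_cutSize_rounding A)).2 fun z _ => ?_
      by_cases hz : z < sSup S
      · filter_upwards [Ioo_mem_nhdsLT hz] with y hy _ using hy.1
      · exact Eventually.of_forall fun y h => absurd h hz
    obtain ⟨y, hy, hyS⟩ := (hev.and self_mem_nhdsWithin).exists
    obtain ⟨_, ⟨T, hT, rfl⟩, hyT⟩ := exists_lt_of_lt_csSup hne hyS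
    replace hT : 0 ≤ T := hT
    have hfast : ∀ t, T ≤ t → ∀ v, IsVelocity A (ξ t) v → c ≤ ‖v‖ ^ 2 := by
      intro t ht v hv
      -- Zero velocity would make the objective a cut size inside this gap.
      refine hspeed _ v hv fun hv0 => ?_
      have h1 := objective_eq_of_force hA (z := ξ t) fun u hu => by
        rw [← hv.inner_eq u hu, hv0, inner_zero_left]
      have h2 := hy _ ⟨(0, ξ t), rfl⟩ (by simpa only [← h1] using hlt t (hT.trans ht))
      simp only [← h1] at h2
      have h3 := hξ.objective_le hA hT ht
      simp only at hyT
      linarith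
    have hs : 0 ≤ (C - objective A (ξ T)) / c + 1 :=
      add_nonneg (div_nonneg (sub_nonneg.2 (hC _)) hc.le) zero_le_one
    have h1 := hξ.mul_sub_le_objective_sub hA hT
      (b := T + ((C - objective A (ξ T)) / c + 1)) (by linarith)
      fun t ht v hv => hfast t ht.1.le v hv
    rw [add_sub_cancel_left, mul_add, mul_div_cancel₀ _ hc.ne'] at h1
    have := hC (ξ (T + ((C - objective A (ξ T)) / c + 1)))
    linarith

/-- Once the objective is constant, `‖v‖ ^ 2 = 0` almost everywhere, and absolute continuity makes
the curve constant. -/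
theorem exists_isTerminalState (hA : A.IsSymm) (hξ : IsTrajectory A ξ) :
    ∃ z, IsTerminalState ξ z := by
  obtain ⟨T, hT, hconst⟩ := hξ.exists_objective_eq hA
  refine ⟨ξ T, T, hT, fun b hb => ?_⟩
  obtain ⟨z, hz⟩ := (hξ.absolutelyContinuousOnInterval hT hb).const_of_ae_hasDerivAt_zero (by
    filter_upwards [hξ.ae_isVelocity hA, (Set.countable_singleton T).ae_notMem volume]
      with t h1 h2 h3
    rw [Set.uIcc_of_le hb] at h3
    have hTt : T < t := lt_of_le_of_ne h3.1 fun h => h2 h.symm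
    obtain ⟨v, -, hv, hv'⟩ := h1 (hT.trans_lt hTt)
    have h4 := hv'.hasDerivAt_objective hA hv
    have h5 : HasDerivAt (fun s => objective A (ξ s)) 0 t := by
      refine (hasDerivAt_const t (objective A (ξ T))).congr_of_eventuallyEq ?_
      filter_upwards [Ioi_mem_nhds hTt] with s hs using hconst s (le_of_lt hs)
    have h6 := h4.unique h5
    rw [sq_eq_zero_iff, norm_eq_zero] at h6
    rwa [h6] at hv)
  rw [hz b Set.right_mem_uIcc, hz T Set.left_mem_uIcc]

theorem isCritical_of_isTerminalState (hξ : IsTrajectory A ξ) {z : EuclideanSpace ℝ V}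
    (hz : IsTerminalState ξ z) : IsCritical A z := by
  obtain ⟨T, hT, h⟩ := hz
  have hfreq : ∃ᶠ t : ℝ in ae volume, t ∈ Set.Ioo T (T + 1) := by
    rw [frequently_ae_mem_iff]
    simp
  obtain ⟨t, ht, hinc⟩ := (hfreq.and_eventually hξ.inclusion).exists
  obtain ⟨v, hv, hd⟩ := hinc (hT.trans_lt ht.1)
  have h0 : HasDerivAt ξ 0 t := by
    refine (hasDerivAt_const t z).congr_of_eventuallyEq ?_
    filter_upwards [Ioi_mem_nhds ht.1] with s hs using h s (le_of_lt hs)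
  rwa [hd.unique h0, h t ht.1.le] at hv

end IsTrajectory

theorem IsCritical.inner_force_eq_zero {A : Matrix V V ℝ} (hA : A.IsSymm) {z : EuclideanSpace ℝ V}
    (hz : IsCritical A z) (u : EuclideanSpace ℝ V) (hu : IsClusterConst z u) :
    inner ℝ (force A z) u = 0 := by
  rw [← inner_eq_of_mem_filippovMap hA hz hu, inner_zero_left]

/-- Along a trajectory, the maximum cut that can be obtained by rounding does not decrease. -/
theorem IsTrajectory.maxRoundedCut_le {A : Matrix V V ℝ} (hA : A.IsSymm)
    {ξ : ℝ → EuclideanSpace ℝ V} (hξ : IsTrajectory A ξ) {T : ℝ} (hT : 0 ≤ T) :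
    maxRoundedCut A (ξ 0) ≤ maxRoundedCut A (ξ T) := by
  obtain ⟨r, hr⟩ := exists_cutSize_ge_of_levelMeasure_pos
    ((levelMeasure_maxRoundedCut_pos A (ξ 0)).trans_le (hξ.levelMeasure_le hA _ hT))
  exact hr.trans ((isGreatest_maxRoundedCut A (ξ T)).2 ⟨r, rfl⟩)

end GW2

namespace GW2

open Filter Topology

/-! ### Locally homogeneous functions -/

section LocallyHomogeneous

variable {E : Type*} [NormedAddCommGroup E] [InnerProductSpace ℝ E]

/-- Functions that are positively homogeneous around each point, such as piecewise linear ones. -/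
def IsLocallyHomogeneous (f : E → ℝ) : Prop :=
  ∀ x, ∃ ρ > 0, ∀ u : E, ∀ l : ℝ, ‖u‖ < ρ → 0 ≤ l → l ≤ 1 →
    f (x + l • u) - f x = l * (f (x + u) - f x)

variable {f : E → ℝ}

/-- Euler's identity. -/
theorem sub_eq_inner_gradient [CompleteSpace E] {x u : E}
    (h : ∀ l : ℝ, 0 ≤ l → l ≤ 1 → f (x + l • u) - f x = l * (f (x + u) - f x))
    (hd : DifferentiableAt ℝ f (x + u)) :
    f (x + u) - f x = inner ℝ (gradient f (x + u)) u := by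
  have hl : HasDerivAt (fun s : ℝ => x + s • u) u 1 := by
    simpa using ((hasDerivAt_id (1 : ℝ)).smul_const u).const_add x
  have h2 : HasFDerivAt f (fderiv ℝ f (x + u)) (x + (1 : ℝ) • u) := by
    simpa using hd.hasFDerivAt
  have h3 : HasDerivWithinAt (fun s : ℝ => f (x + s • u)) (fderiv ℝ f (x + u) u)
      (Set.Icc 0 1) 1 := (HasFDerivAt.comp_hasDerivAt (l := f) (1 : ℝ) h2 hl).hasDerivWithinAt
  have h4 : HasDerivWithinAt (fun s : ℝ => f (x + s • u)) (f (x + u) - f x)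
      (Set.Icc 0 1) 1 := by
    have h5 : HasDerivAt (fun s : ℝ => f x + s * (f (x + u) - f x)) (f (x + u) - f x) 1 := by
      simpa using ((hasDerivAt_id (1 : ℝ)).mul_const (f (x + u) - f x)).const_add (f x)
    refine h5.hasDerivWithinAt.congr (fun l hl => ?_) ?_
    · linarith [h l hl.1 hl.2]
    · simp
  rw [inner_gradient_left]
  exact (uniqueDiffOn_Icc zero_lt_one 1 (Set.right_mem_Icc.2 zero_le_one)).eq_deriv _ h4 h3

theorem norm_gradient_le [CompleteSpace E] {K : NNReal} (hK : LipschitzWith K f) (x : E) : ‖gradient f x‖ ≤ K := by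
  rw [gradient, LinearIsometryEquiv.norm_map]
  exact norm_fderiv_le_of_lipschitz ℝ hK

end LocallyHomogeneous

/-! ### Straight solutions of the gradient inclusion -/

section Filippov

variable {E : Type*} [NormedAddCommGroup E] [InnerProductSpace ℝ E] [FiniteDimensional ℝ E]
  [MeasureSpace E] [BorelSpace E] [(volume : Measure E).IsAddHaarMeasure]

/-- A vector that majorizes the increments of a locally homogeneous Lipschitz function to first
order belongs to the Filippov set of its gradient. -/
theorem mem_filippovMap_gradient {f : E → ℝ} {K : NNReal} (hK : LipschitzWith K f)
    (hf : IsLocallyHomogeneous f) {y w : E} {C : ℝ}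
    (h : ∀ᶠ z in 𝓝 y, f z - f y ≤ inner ℝ w (z - y) + C * ‖z - y‖ ^ 2) :
    w ∈ filippovMap (gradient f) y := by
  simp only [filippovMap, Set.mem_iInter]
  intro δ hδ N hN
  by_contra hw
  -- If `w` were outside the hull, a direction `p` would separate it strictly from all nearby
  -- gradients; the growth of `f` from `y` along `p` then exceeds the assumed bound.
  obtain ⟨l, c, hlw, hlc⟩ := geometric_hahn_banach_point_closed convex_closedConvexHull
    isClosed_closedConvexHull hw
  obtain ⟨ρ, hρ, hhom⟩ := hf y
  obtain ⟨p, rfl⟩ := (InnerProductSpace.toDual ℝ E).surjective l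
  simp only [InnerProductSpace.toDual_apply_apply] at hlw hlc
  have hcont : Continuous fun s : ℝ => y + s • p := by fun_prop
  have hlim : Tendsto (fun s : ℝ => y + s • p) (𝓝[>] 0) (𝓝 y) := by
    have := hcont.tendsto 0
    rw [zero_smul, add_zero] at this
    exact this.mono_left nhdsWithin_le_nhds
  have hsmall : ∀ᶠ s in 𝓝[>] (0 : ℝ), C * s * ‖p‖ ^ 2 < c - inner ℝ p w := by
    have hc : Continuous fun s : ℝ => C * s * ‖p‖ ^ 2 := by fun_prop
    refine (hc.tendsto 0).mono_left nhdsWithin_le_nhds |>.eventually_lt_const ?_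
    simpa using hlw
  obtain ⟨s, ⟨⟨hs1, hs2⟩, hs3⟩, hs0⟩ := (((hlim.eventually h).and hsmall).and
    (hlim.eventually (Metric.ball_mem_nhds y (lt_min hδ hρ)))).and self_mem_nhdsWithin |>.exists
  replace hs0 : 0 < s := hs0
  have hnull : volume (N ∪ {z | ¬DifferentiableAt ℝ f z}) = 0 :=
    measure_union_null hN hK.ae_differentiableAt
  have hdense : Dense (N ∪ {z | ¬DifferentiableAt ℝ f z})ᶜ :=
    Measure.dense_of_ae (measure_eq_zero_iff_ae_notMem.1 hnull)
  -- The ray may lie in the null set, so the growth estimate is proved at good points with a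
  -- Lipschitz error and carried to the ray by density.
  have hclosed : IsClosed {z | s * c ≤ f z - f y + K * ‖z - (y + s • p)‖} :=
    isClosed_le continuous_const ((hK.continuous.sub continuous_const).add
      (continuous_const.mul (continuous_id.sub continuous_const).norm))
  have hsub : Metric.ball y (min δ ρ) ∩ (N ∪ {z | ¬DifferentiableAt ℝ f z})ᶜ ⊆
      {z | s * c ≤ f z - f y + K * ‖z - (y + s • p)‖} := by
    rintro z ⟨hz, hzN⟩
    rw [Set.mem_compl_iff, Set.mem_union, not_or] at hzN
    have hzd : DifferentiableAt ℝ f (y + (z - y)) := by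
      rw [add_sub_cancel]; exact not_not.1 hzN.2
    rw [mem_ball_iff_norm] at hz
    have h1 := sub_eq_inner_gradient (fun l h0 h1 => hhom (z - y) l
      (hz.trans_le (min_le_right _ _)) h0 h1) hzd
    rw [add_sub_cancel] at h1
    have h2 := hlc (gradient f z) (subset_closedConvexHull ⟨z,
      ⟨mem_ball_iff_norm.2 (hz.trans_le (min_le_left _ _)), hzN.1⟩, rfl⟩)
    have h3 : inner ℝ (gradient f z) (z - y) =
        s * inner ℝ p (gradient f z) + inner ℝ (gradient f z) (z - (y + s • p)) := by
      rw [real_inner_comm (gradient f z) p, ← inner_smul_right, ← inner_add_right]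
      congr 1
      abel
    have h4 : -(K * ‖z - (y + s • p)‖) ≤ inner ℝ (gradient f z) (z - (y + s • p)) := by
      refine neg_le_of_abs_le ((abs_real_inner_le_norm _ _).trans ?_)
      exact mul_le_mul_of_nonneg_right (norm_gradient_le hK z) (norm_nonneg _)
    change s * c ≤ _
    rw [h1, h3]
    have := mul_le_mul_of_nonneg_left h2.le hs0.le
    linarith
  have hz := closure_minimal hsub hclosed (hdense.open_subset_closure_inter Metric.isOpen_ball hs3)
  replace hz : s * c ≤ f (y + s • p) - f y + K * ‖y + s • p - (y + s • p)‖ := hz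
  rw [sub_self, norm_zero, mul_zero, add_zero] at hz
  rw [add_sub_cancel_left, inner_smul_right, norm_smul, Real.norm_eq_abs, abs_of_pos hs0,
    real_inner_comm] at hs1
  have h5 : s * c ≤ s * (inner ℝ p w + C * s * ‖p‖ ^ 2) := by
    refine hz.trans (hs1.trans_eq ?_)
    ring
  have := le_of_mul_le_mul_left h5 hs0
  linarith

/-- From each point the gradient inclusion has a solution that is a segment: it points to the
maximizer of `f` penalized by the squared distance. -/
theorem exists_forall_mem_filippovMap_gradient {f : E → ℝ} {K : NNReal} (hK : LipschitzWith K f)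
    (hf : IsLocallyHomogeneous f) (x : E) : ∃ w : E, ‖w‖ ≤ 2 * K ∧ ∃ ε > 0, ∀ t : ℝ, 0 < t →
      t < ε → w ∈ filippovMap (gradient f) (x + t • w) := by
  obtain ⟨ρ, hρ, hhom⟩ := hf x
  -- With this `s` the maximizer has norm at most `s * (2 * K) < ρ / 2`, hence is interior.
  obtain ⟨s, hs, hsK⟩ : ∃ s > 0, s * (2 * (K : ℝ)) < ρ / 2 := by
    refine ⟨ρ / 2 / (2 * K + 1), by positivity, ?_⟩
    rw [div_mul_eq_mul_div, div_lt_iff₀ (by positivity)]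
    exact mul_lt_mul_of_pos_left (by linarith) (by positivity)
  obtain ⟨u, hu, hmax⟩ := (isCompact_closedBall (0 : E) (ρ / 2)).exists_isMaxOn
    ⟨0, Metric.mem_closedBall_self (by positivity)⟩
    (f := fun u => f (x + u) - ‖u‖ ^ 2 / (2 * s))
    (Continuous.continuousOn (by have := hK.continuous; fun_prop))
  have hle : ‖u‖ ≤ s * (2 * K) := by
    have h0 := hmax (Metric.mem_closedBall_self (by positivity : 0 ≤ ρ / 2))
    simp only [Set.mem_ofPred_eq, add_zero, norm_zero] at h0
    have h1 := (le_abs_self _).trans (hK.norm_sub_le (x + u) x)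
    rw [add_sub_cancel_left] at h1
    have h2 : ‖u‖ ^ 2 / (2 * s) ≤ K * ‖u‖ := by
      simp only [ne_eq, OfNat.ofNat_ne_zero, not_false_eq_true, zero_pow, zero_div, sub_zero] at h0
      linarith
    rw [div_le_iff₀ (by positivity)] at h2
    rcases (norm_nonneg u).eq_or_lt with h | h
    · rw [← h]; positivity
    · exact le_of_mul_le_mul_right (by linarith) h
  refine ⟨s⁻¹ • u, ?_, s, hs, fun t ht0 hts => ?_⟩
  · rw [norm_smul, norm_inv, Real.norm_eq_abs, abs_of_pos hs]
    rwa [inv_mul_le_iff₀ hs]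
  · obtain ⟨l, hl0, hl1, rfl⟩ : ∃ l, 0 < l ∧ l < 1 ∧ t = l * s :=
      ⟨t / s, div_pos ht0 hs, (div_lt_one hs).2 hts, (div_mul_cancel₀ t hs.ne').symm⟩
    rw [smul_smul, mul_inv_cancel_right₀ hs.ne']
    -- Homogeneity scales the maximality inequality at `x + u` down to `x + l • u`; the quadratic
    -- error becomes `‖z - y‖ ^ 2 / (2 * s * l)`.
    refine mem_filippovMap_gradient hK hf (C := 1 / (2 * s * l)) ?_
    have hcont : Continuous fun z : E => l⁻¹ • (z - x) := by fun_prop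
    have hmem : ∀ᶠ z in 𝓝 (x + l • u), l⁻¹ • (z - x) ∈ Metric.ball (0 : E) (ρ / 2) := by
      refine hcont.continuousAt.eventually_mem (Metric.isOpen_ball.mem_nhds ?_)
      rw [add_sub_cancel_left, inv_smul_smul₀ hl0.ne', mem_ball_zero_iff]
      exact hle.trans_lt hsK
    filter_upwards [hmem] with z hz
    obtain ⟨q, rfl⟩ : ∃ q, z = x + l • (u + q) :=
      ⟨l⁻¹ • (z - x) - u, by rw [add_sub_cancel, smul_inv_smul₀ hl0.ne', add_sub_cancel]⟩
    rw [add_sub_cancel_left, inv_smul_smul₀ hl0.ne'] at hz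
    have h1 := hmax (Metric.ball_subset_closedBall hz)
    simp only [Set.mem_ofPred_eq] at h1
    rw [mem_ball_zero_iff] at hz
    have h2 := hhom (u + q) l (by linarith) hl0.le hl1.le
    have h3 := hhom u l (by linarith) hl0.le hl1.le
    have h4 : x + l • (u + q) - (x + l • u) = l • q := by
      rw [smul_add]; abel
    have h5 : f (x + (u + q)) - f (x + u) ≤ (2 * inner ℝ u q + ‖q‖ ^ 2) / (2 * s) := by
      rw [norm_add_sq_real] at h1
      have : (2 * inner ℝ u q + ‖q‖ ^ 2) / (2 * s) =
        (‖u‖ ^ 2 + 2 * inner ℝ u q + ‖q‖ ^ 2) / (2 * s) - ‖u‖ ^ 2 / (2 * s) := by ring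
      linarith
    have h6 : f (x + l • (u + q)) - f (x + l • u) = l * (f (x + (u + q)) - f (x + u)) := by
      linarith
    rw [h4, h6, inner_smul_left, inner_smul_right, norm_smul, Real.norm_eq_abs, abs_of_pos hl0]
    refine (mul_le_mul_of_nonneg_left h5 hl0.le).trans_eq ?_
    simp only [conj_trivial]
    field_simp

end Filippov

/-! ### Gluing to a global solution -/

section Zorn

variable {E : Type*} [NormedAddCommGroup E] [NormedSpace ℝ E]

/-- Lipschitz solutions of the differential inclusion given by `F` on intervals `[0, T)`. -/
structure PartialSolution (F : E → Set E) (C : ℝ) (x : E) where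
  /-- The end of the interval of existence. -/
  endTime : EReal
  /-- The solution curve. -/
  curve : ℝ → E
  curve_zero : curve 0 = x
  endTime_nonneg : 0 ≤ endTime
  norm_sub_le : ∀ s t : ℝ, 0 ≤ s → s ≤ t → t < endTime → ‖curve t - curve s‖ ≤ C * (t - s)
  inclusion : ∀ᵐ t : ℝ, 0 < t → t < endTime → ∃ v ∈ F (curve t), HasDerivAt curve v t

namespace PartialSolution

variable {F : E → Set E} {C : ℝ} {x : E}

/-- The relation of one solution being extended by another. -/
def Extends (p q : PartialSolution F C x) : Prop :=
  p.endTime ≤ q.endTime ∧ ∀ t : ℝ, 0 ≤ t → t < p.endTime → q.curve t = p.curve t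

theorem Extends.trans {p q r : PartialSolution F C x} (h : p.Extends q) (h' : q.Extends r) :
    p.Extends r :=
  ⟨h.1.trans h'.1, fun t h0 ht => (h'.2 t h0 (ht.trans_le h.1)).trans (h.2 t h0 ht)⟩

theorem eventually_pos_lt {T : EReal} {t : ℝ} (h0 : 0 < t) (ht : (t : EReal) < T) :
    ∀ᶠ s : ℝ in 𝓝 t, 0 < s ∧ (s : EReal) < T :=
  (lt_mem_nhds h0).and ((continuous_coe_real_ereal.tendsto t).eventually_lt_const ht)

theorem exists_upperBound {c : Set (PartialSolution F C x)} (hc : IsChain Extends c) :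
    ∃ q : PartialSolution F C x, ∀ p ∈ c, p.Extends q := by
  classical
  rcases c.eq_empty_or_nonempty with rfl | ⟨p₀, hp₀⟩
  · exact ⟨⟨0, fun _ => x, rfl, le_rfl, fun s t h0 hst ht =>
      absurd (h0.trans hst) (not_le.2 (by exact_mod_cast ht)), Eventually.of_forall fun t h0 ht =>
      absurd h0 (not_lt.2 (by exact_mod_cast ht.le))⟩, fun p hp => absurd hp (by simp)⟩
  let γ : ℝ → E := fun t => if h : ∃ p ∈ c, (t : EReal) < p.endTime then h.choose.curve t else x
  have hγ : ∀ p ∈ c, ∀ t : ℝ, 0 ≤ t → (t : EReal) < p.endTime → γ t = p.curve t := by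
    intro p hp t h0 ht
    have h : ∃ p ∈ c, (t : EReal) < p.endTime := ⟨p, hp, ht⟩
    simp only [γ, dif_pos h]
    obtain ⟨hq, hq'⟩ := h.choose_spec
    by_cases heq : h.choose = p
    · rw [heq]
    · rcases hc hq hp heq with H | H
      · exact (H.2 t h0 hq').symm
      · exact H.2 t h0 ht
  have hlt : ∀ t : ℝ, (t : EReal) < ⨆ p ∈ c, p.endTime → ∃ p ∈ c, (t : EReal) < p.endTime := by
    intro t ht
    simpa only [lt_iSup_iff, exists_prop] using ht
  refine ⟨⟨⨆ p ∈ c, p.endTime, γ, ?_, ?_, ?_, ?_⟩, ?_⟩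
  · by_cases h : ∃ p ∈ c, ((0 : ℝ) : EReal) < p.endTime
    · simp only [γ, dif_pos h]
      exact h.choose.curve_zero
    · simp only [γ, dif_neg h]
  · exact p₀.endTime_nonneg.trans (le_biSup endTime hp₀)
  · intro s t h0 hst ht
    obtain ⟨p, hp, htp⟩ := hlt t ht
    rw [hγ p hp t (h0.trans hst) htp,
      hγ p hp s h0 (lt_of_le_of_lt (by exact_mod_cast hst) htp)]
    exact p.norm_sub_le s t h0 hst htp
  · have h : ∀ᵐ t : ℝ, ∀ q : ℚ, ∀ hq : ((q : ℝ) : EReal) < ⨆ p ∈ c, p.endTime, 0 < t →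
        t < (hlt q hq).choose.endTime → ∃ v ∈ F ((hlt q hq).choose.curve t),
          HasDerivAt (hlt q hq).choose.curve v t :=
      ae_all_iff.2 fun q => ae_all_iff.2 fun hq => (hlt q hq).choose.inclusion
    filter_upwards [h] with t ht h0 hlt'
    obtain ⟨q, hq, hq'⟩ := EReal.lt_iff_exists_rat_btwn.1 hlt'
    replace hq : (t : EReal) < ((q : ℝ) : EReal) := hq
    replace hq' : ((q : ℝ) : EReal) < ⨆ p ∈ c, p.endTime := hq'
    obtain ⟨hp, hqp⟩ := (hlt q hq').choose_spec
    obtain ⟨v, hv, hd⟩ := ht q hq' h0 (hq.trans hqp)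
    refine ⟨v, ?_, ?_⟩
    · rwa [hγ _ hp t h0.le (hq.trans hqp)]
    · refine hd.congr_of_eventuallyEq ?_
      filter_upwards [eventually_pos_lt h0 (hq.trans hqp)] with s hs
        using hγ _ hp s hs.1.le hs.2
  · exact fun p hp => ⟨le_biSup endTime hp, hγ p hp⟩

/-- The Lipschitz bound makes the curve Cauchy at its end. If `τ = 0` the interval is empty and the
initial point serves as limit. -/
theorem exists_left_limit [CompleteSpace E] (p : PartialSolution F C x) {τ : ℝ}
    (hτ : p.endTime = τ) : ∃ y : E, (τ = 0 → y = x) ∧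
      ∀ s : ℝ, 0 ≤ s → s < τ → ‖y - p.curve s‖ ≤ C * (τ - s) := by
  have h0 : 0 ≤ τ := by
    have := p.endTime_nonneg
    rw [hτ] at this
    exact_mod_cast this
  rcases h0.eq_or_lt with rfl | h0
  · exact ⟨x, fun _ => rfl, fun s hs hs' => absurd hs (not_le.2 hs')⟩
  have hle : ∀ s t : ℝ, 0 ≤ s → s ≤ t → t < τ → ‖p.curve t - p.curve s‖ ≤ C * (t - s) :=
    fun s t hs hst ht => p.norm_sub_le s t hs hst (by rw [hτ]; exact_mod_cast ht)
  have hcauchy : Cauchy (map p.curve (𝓝[<] τ)) := by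
    rw [Metric.cauchy_iff]
    refine ⟨inferInstance, fun ε hε => ?_⟩
    have hC : 0 ≤ C := by
      have := (norm_nonneg _).trans (hle 0 (τ / 2) le_rfl (by linarith) (by linarith))
      nlinarith
    have hmem : Set.Ioo (max 0 (τ - ε / (C + 1))) τ ∈ 𝓝[<] τ := by
      refine Ioo_mem_nhdsLT (max_lt h0 ?_)
      have : 0 < ε / (C + 1) := by positivity
      linarith
    have key : ∀ s t : ℝ, s ∈ Set.Ioo (max 0 (τ - ε / (C + 1))) τ →
        t ∈ Set.Ioo (max 0 (τ - ε / (C + 1))) τ → s ≤ t → ‖p.curve t - p.curve s‖ < ε := by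
      intro s t hs ht hst
      obtain ⟨hs1, hs2⟩ := max_lt_iff.1 hs.1
      refine (hle s t hs1.le hst ht.2).trans_lt ?_
      have h1 : t - s < ε / (C + 1) := by linarith [ht.2]
      rw [lt_div_iff₀ (by positivity)] at h1
      nlinarith
    refine ⟨p.curve '' Set.Ioo (max 0 (τ - ε / (C + 1))) τ, image_mem_map hmem, ?_⟩
    rintro _ ⟨s, hs, rfl⟩ _ ⟨t, ht, rfl⟩
    rw [dist_eq_norm]
    rcases le_total s t with h | h
    · rw [norm_sub_rev]; exact key s t hs ht h
    · exact key t s ht hs h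
  obtain ⟨y, hy⟩ := CompleteSpace.complete hcauchy
  refine ⟨y, fun h => absurd h h0.ne', fun s hs hsτ => ?_⟩
  have h1 : Tendsto (fun t => ‖p.curve t - p.curve s‖) (𝓝[<] τ) (𝓝 ‖y - p.curve s‖) :=
    (Tendsto.sub hy tendsto_const_nhds).norm
  have h2 : Tendsto (fun t => C * (t - s)) (𝓝[<] τ) (𝓝 (C * (τ - s))) :=
    (Continuous.tendsto (by fun_prop) τ).mono_left nhdsWithin_le_nhds
  refine le_of_tendsto_of_tendsto h1 h2 ?_
  filter_upwards [Ioo_mem_nhdsLT hsτ] with t ht using hle s t hs ht.1.le ht.2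

theorem exists_extends_of_endTime_ne_top [CompleteSpace E] (p : PartialSolution F C x)
    (hlocal : ∀ y, ∃ w : E, ‖w‖ ≤ C ∧ ∃ ε > 0, ∀ t : ℝ, 0 < t → t < ε → w ∈ F (y + t • w))
    (hp : p.endTime ≠ ⊤) : ∃ q : PartialSolution F C x, p.Extends q ∧ p.endTime < q.endTime := by
  have hbot : p.endTime ≠ ⊥ := fun h => by simpa [h] using p.endTime_nonneg
  obtain ⟨τ, hτ⟩ : ∃ τ : ℝ, p.endTime = τ := ⟨_, (EReal.coe_toReal hp hbot).symm⟩
  have h0 : 0 ≤ τ := by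
    have := p.endTime_nonneg
    rw [hτ] at this
    exact_mod_cast this
  obtain ⟨y, hy0, hy⟩ := p.exists_left_limit hτ
  obtain ⟨w, hwC, ε, hε, hw⟩ := hlocal y
  -- The straight solution is attached at the left limit, since the old curve is unconstrained at
  -- and beyond `τ` (apart from its value at `0`).
  let γ : ℝ → E := fun t => if t < τ then p.curve t else y + (t - τ) • w
  have hγl : ∀ t, t < τ → γ t = p.curve t := fun t ht => if_pos ht
  have hγr : ∀ t, τ ≤ t → γ t = y + (t - τ) • w := fun t ht => if_neg (not_lt.2 ht)
  have hray : ∀ a : ℝ, 0 ≤ a → ‖a • w‖ ≤ C * a := fun a ha => by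
    rw [norm_smul, Real.norm_eq_abs, abs_of_nonneg ha, mul_comm]
    exact mul_le_mul_of_nonneg_right hwC ha
  refine ⟨⟨((τ + ε : ℝ) : EReal), γ, ?_, ?_, ?_, ?_⟩, ⟨?_, ?_⟩, ?_⟩
  · rcases h0.eq_or_lt with h | h
    · rw [hγr 0 h.ge, ← h, hy0 h.symm, sub_self, zero_smul, add_zero]
    · rw [hγl 0 h, p.curve_zero]
  · exact_mod_cast (by linarith : 0 ≤ τ + ε)
  · intro s t hs hst _
    rcases lt_or_ge t τ with ht | ht
    · rw [hγl t ht, hγl s (hst.trans_lt ht)]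
      exact p.norm_sub_le s t hs hst (by rw [hτ]; exact_mod_cast ht)
    · rw [hγr t ht]
      rcases lt_or_ge s τ with hsτ | hsτ
      · rw [hγl s hsτ, add_sub_right_comm]
        refine (norm_add_le _ _).trans ?_
        have := hy s hs hsτ
        have := hray (t - τ) (by linarith)
        linarith
      · rw [hγr s hsτ, add_sub_add_left_eq_sub, ← sub_smul, sub_sub_sub_cancel_right]
        exact hray _ (by linarith)
  · filter_upwards [p.inclusion, (Set.countable_singleton τ).ae_notMem volume]
      with t hinc hne ht0 htε
    rcases lt_or_gt_of_ne (fun h => hne h : t ≠ τ) with ht | ht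
    · obtain ⟨v, hv, hd⟩ := hinc ht0 (by rw [hτ]; exact_mod_cast ht)
      refine ⟨v, by rwa [hγl t ht], hd.congr_of_eventuallyEq ?_⟩
      filter_upwards [Iio_mem_nhds ht] with s hs using hγl s hs
    · have htε' : t < τ + ε := by exact_mod_cast htε
      refine ⟨w, ?_, ?_⟩
      · rw [hγr t ht.le]
        exact hw _ (by linarith) (by linarith)
      · have : HasDerivAt (fun s : ℝ => y + (s - τ) • w) w t := by
          simpa using (((hasDerivAt_id t).sub_const τ).smul_const w).const_add y
        refine this.congr_of_eventuallyEq ?_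
        filter_upwards [Ioi_mem_nhds ht] with s hs using hγr s (le_of_lt hs)
  · exact hτ.le.trans (EReal.coe_le_coe_iff.2 (by linarith))
  · intro t _ ht
    rw [hτ] at ht
    exact hγl t (by exact_mod_cast ht)
  · exact hτ.trans_lt (EReal.coe_lt_coe_iff.2 (by linarith))

theorem exists_endTime_eq_top [CompleteSpace E] (x : E)
    (hlocal : ∀ y, ∃ w : E, ‖w‖ ≤ C ∧ ∃ ε > 0, ∀ t : ℝ, 0 < t → t < ε → w ∈ F (y + t • w)) :
    ∃ p : PartialSolution F C x, p.endTime = ⊤ := by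
  obtain ⟨p, hp⟩ := exists_maximal_of_chains_bounded (r := Extends (F := F) (C := C) (x := x))
    (fun c hc => exists_upperBound hc) Extends.trans
  refine ⟨p, by_contra fun hne => ?_⟩
  obtain ⟨q, hpq, hlt⟩ := p.exists_extends_of_endTime_ne_top hlocal hne
  exact absurd (hp q hpq).1 (not_le.2 hlt)

end PartialSolution

end Zorn

/-- Existence of trajectories. -/
theorem exists_isTrajectory {V : Type*} [Fintype V] (A : Matrix V V ℝ) (x : EuclideanSpace ℝ V) :
    ∃ ξ, IsTrajectory A ξ ∧ ξ 0 = x := by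
  obtain ⟨K, hK⟩ := exists_lipschitzWith_objective A
  obtain ⟨p, hp⟩ := PartialSolution.exists_endTime_eq_top x
    (exists_forall_mem_filippovMap_gradient hK (objective_locally_homogeneous A))
  have htop : ∀ t : ℝ, (t : EReal) < p.endTime := fun t => hp ▸ EReal.coe_lt_top t
  refine ⟨p.curve, ⟨fun T hT => ?_, ?_⟩, p.curve_zero⟩
  · have hlip : LipschitzOnWith (2 * K) p.curve (Set.uIcc 0 T) := by
      refine LipschitzOnWith.of_dist_le_mul fun s hs t ht => ?_
      rw [Set.uIcc_of_le hT.le] at hs ht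
      rw [dist_eq_norm, Real.dist_eq]
      push_cast
      rcases le_total s t with h | h
      · rw [norm_sub_rev, abs_sub_comm, abs_of_nonneg (sub_nonneg.2 h)]
        exact p.norm_sub_le s t hs.1 h (htop t)
      · rw [abs_of_nonneg (sub_nonneg.2 h)]
        exact p.norm_sub_le t s ht.1 h (htop s)
    exact hlip.absolutelyContinuousOnInterval
  · filter_upwards [p.inclusion] with t ht h0 using ht h0 (htop t)

end GW2

theorem theorem5 {V : Type*} [Fintype V] (A : Matrix V V ℝ) (hA : A.IsSymm)
    (ξ₀ : EuclideanSpace ℝ V) :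
    (∃ ξ : ℝ → EuclideanSpace ℝ V, GW2.IsTrajectory A ξ ∧ ξ 0 = ξ₀) ∧
    ∀ ξ : ℝ → EuclideanSpace ℝ V, GW2.IsTrajectory A ξ → ξ 0 = ξ₀ →
      ∃ z : EuclideanSpace ℝ V,
        GW2.IsTerminalState ξ z ∧ GW2.IsCritical A z ∧
        (∀ r s : ℝ, GW2.cutSize A (GW2.rounding r z) = GW2.cutSize A (GW2.rounding s z)) ∧
        ∀ r : ℝ, GW2.maxRoundedCut A ξ₀ ≤ GW2.cutSize A (GW2.rounding r z) := by
  refine ⟨GW2.exists_isTrajectory A ξ₀, ?_⟩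
  rintro ξ hξ rfl
  obtain ⟨z, hz⟩ := hξ.exists_isTerminalState hA
  have hcrit := hξ.isCritical_of_isTerminalState hz
  have hcut := GW2.cutSize_rounding_eq_of_force hA (hcrit.inner_force_eq_zero hA)
  refine ⟨z, hz, hcrit, hcut, fun r => ?_⟩
  obtain ⟨T, hT, hTz⟩ := hz
  have hle := hξ.maxRoundedCut_le hA hT
  rw [hTz T le_rfl] at hle
  -- The maximum at `z` is attained by some center, and all centers give the same cut there.
  obtain ⟨s, hs⟩ := (GW2.isGreatest_maxRoundedCut A z).1
  exact hle.trans (hs.symm.trans_le (hcut s r).le)
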